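/- Let $f,g:\mathbb{C}\to\mathbb{C}$ be transcendental entire functions (entire and not polynomial), and let $S=\langle f,g\rangle$ be the semigroup of all finite compositions of one or more of the maps $f,g$. For $h\in S$ let $J(h)\subset\mathbb{C}$ be the Julia set of $h$, i.e. the complement of the set of points of $\mathbb{C}$ having a neighbourhood on which the family of iterates $\{h^n:n\ge 1\}$ is normal (locally uniform convergence to $\infty$ being allowed). A set $E\subset\mathbb{C}$ is completely invariant under $h$ if $h(E)\subset E$ and $h^{-1}(E)\subset E$. Define the completely invariant Julia set of $S$ by $$E(S)=\bigcap\{E\subset\mathbb{C}: E \text{ is closed},\ E\text{ is completely invariant under each } h\in S,\ \#(E)\ge 3\}.$$ Put $$\mathscr{E}_0=\{J(h):h\in S\},\qquad \mathscr{E}_{n+1}=\{h^{-1}(A):h\in S,\ A\in\mathscr{E}_n\}\cup\{h(A):h\in S,\ A\in\mathscr{E}_n\}\quad(n\ge 0),\qquad \mathscr{E}=\bigcup_{n=0}^{\infty}\mathscr{E}_n.$$ Then $$E(S)=\overline{\bigcup_{A\in\mathscr{E}}A},$$ where the closure is taken in $\mathbb{C}$. -/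

import Mathlib

namespace TransSemigroup

/-- A transcendental entire function: entire and not a polynomial. -/
def IsTranscendentalEntire (f : ℂ → ℂ) : Prop :=
  Differentiable ℂ f ∧ ∀ p : Polynomial ℂ, f ≠ fun z => p.eval z

/-- `h` is a composition of finitely many (one or more) maps from `A`. -/
inductive IsComposition (A : Set (ℂ → ℂ)) : (ℂ → ℂ) → Prop
  | of {a : ℂ → ℂ} (ha : a ∈ A) : IsComposition A a
  | comp {h k : ℂ → ℂ} (hh : IsComposition A h) (hk : IsComposition A k) : IsComposition A (h ∘ k)

/-- The semigroup generated by a set of self-maps of the plane under composition. -/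
def generated (A : Set (ℂ → ℂ)) : Set (ℂ → ℂ) := {h | IsComposition A h}

/-- Locally uniform convergence to `∞` on `U`. -/
def TendstoInftyLocallyUniformlyOn (s : ℕ → ℂ → ℂ) (U : Set ℂ) : Prop :=
  ∀ K ⊆ U, IsCompact K → ∀ M : ℝ, ∀ᶠ n in Filter.atTop, ∀ z ∈ K, M < ‖s n z‖

/-- Normality of a family of entire functions on a domain `U`: every sequence in the family has
a subsequence converging locally uniformly on `U`, either to a finite function or to `∞`. -/
def IsNormalOn (F : Set (ℂ → ℂ)) (U : Set ℂ) : Prop :=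
  ∀ s : ℕ → ℂ → ℂ, (∀ n, s n ∈ F) → ∃ φ : ℕ → ℕ, StrictMono φ ∧
    ((∃ g : ℂ → ℂ, TendstoLocallyUniformlyOn (fun n => s (φ n)) g Filter.atTop U) ∨
      TendstoInftyLocallyUniformlyOn (fun n => s (φ n)) U)

/-- The Fatou set: the points that have a neighbourhood (equivalently, an open disc about them)
on which the family is normal. -/
def fatouSet (S : Set (ℂ → ℂ)) : Set ℂ :=
  {z | ∃ r > 0, IsNormalOn S (Metric.ball z r)}

/-- The Julia set of a single map `h`: the complement of the Fatou set of the cyclic semigroup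
`⟨h⟩ = {h, h ∘ h, …}`. -/
def juliaSet (h : ℂ → ℂ) : Set ℂ := (fatouSet (generated {h}))ᶜ

/-- Forward and backward invariance. -/
def CompletelyInvariant (h : ℂ → ℂ) (E : Set ℂ) : Prop :=
  h '' E ⊆ E ∧ h ⁻¹' E ⊆ E

/-- The completely invariant Julia set `E(S)`: the intersection of all closed sets with at least
three points that are completely invariant under each element of `S`. -/
def completelyInvariantJulia (S : Set (ℂ → ℂ)) : Set ℂ :=
  ⋂₀ {E | IsClosed E ∧ (∀ h ∈ S, CompletelyInvariant h E) ∧ 3 ≤ E.encard}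

/-- The collections `𝓔ₙ`: `𝓔₀` consists of the Julia sets of the elements of `S`, and `𝓔ₙ₊₁`
of all preimages and all images of members of `𝓔ₙ` under elements of `S`. -/
def level (S : Set (ℂ → ℂ)) : ℕ → Set (Set ℂ)
  | 0 => {A | ∃ h ∈ S, A = juliaSet h}
  | n + 1 => {A | ∃ h ∈ S, ∃ B ∈ level S n, A = h ⁻¹' B} ∪
      {A | ∃ h ∈ S, ∃ B ∈ level S n, A = h '' B}

/-- The collection `𝓔`, the union of all `𝓔ₙ`. -/
def orbitCollection (S : Set (ℂ → ℂ)) : Set (Set ℂ) := ⋃ n, level S n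

end TransSemigroup

/-! Let C be the closure on the right. It is forward invariant by continuity and backward invariant
because nonconstant entire maps are open. It contains J(f), so once J(f) is known to be infinite, C
is one of the sets being intersected. Conversely, let E be any such set. The iterates of h map the
complement of E into itself, hence omit two points there, and Montel's test gives J(h) ⊆ E. Complete
invariance then carries the inclusion through all levels.

The weight lies in the infinitude of J(f) (`IsTranscendentalEntire.infinite_juliaSet`). If J(f) were
finite, its complement D would be a connected neighbourhood of ∞ on which the iterates are normal.
The map F = f ∘ f has arbitrarily large fixed points (`exists_large_fixed_point`), hence two in D.
They force iterates of F along a subsequence to have a finite nonconstant limit G, and iterates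
along the gaps of the exponents to tend to some H with H ∘ G = G. So H is the identity, f is
injective near ∞, and f is a polynomial.

Normality is measured by the spherical derivative: `exists_subseq_of_sph_bounded` (Marty) turns
local bounds into convergence, and `zalcman` turns the failure of a bound into a nonconstant entire
limit. Montel and Picard follow from these, and the fixed-point theorem from a rescaling of f(z)/z.
-/

namespace TransSemigroup

open Filter Metric Set Topology

/-! ### The spherical derivative -/

/-- The spherical derivative. -/
noncomputable def sph (f : ℂ → ℂ) (z : ℂ) : ℝ := ‖deriv f z‖ / (1 + ‖f z‖ ^ 2)

theorem sph_nonneg (f : ℂ → ℂ) (z : ℂ) : 0 ≤ sph f z := by unfold sph; positivity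

theorem norm_deriv_le_of_ball {f : ℂ → ℂ} {x : ℂ} {r M : ℝ} (hr : 0 < r)
    (hf : DifferentiableOn ℂ f (ball x r)) (hM : ∀ z ∈ ball x r, ‖f z‖ ≤ M) :
    ‖deriv f x‖ ≤ 2 * M / r := by
  have hsub : closedBall x (r / 2) ⊆ ball x r := closedBall_subset_ball (by linarith)
  have h := Complex.norm_deriv_le_of_forall_mem_sphere_norm_le (c := x) (R := r / 2) (C := M)
    (by linarith) (hf.mono (by rwa [closure_ball _ (by positivity)])).diffContOnCl
    (fun z hz => hM z (hsub (sphere_subset_closedBall hz)))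
  calc _ ≤ _ := h
    _ = _ := by field_simp

theorem sph_le_norm_deriv (f : ℂ → ℂ) (z : ℂ) : sph f z ≤ ‖deriv f z‖ :=
  div_le_self (norm_nonneg _) (by nlinarith [sq_nonneg ‖f z‖])

theorem norm_deriv_eq_sph_mul (f : ℂ → ℂ) (z : ℂ) :
    ‖deriv f z‖ = sph f z * (1 + ‖f z‖ ^ 2) := by
  unfold sph
  have : 1 + ‖f z‖ ^ 2 ≠ 0 := by positivity
  field_simp

/-- Inversion is an isometry of the sphere, so estimates near ∞ reduce to estimates near 0. -/
theorem sph_inv {f : ℂ → ℂ} {z : ℂ} (hf : DifferentiableAt ℂ f z) (hz : f z ≠ 0) :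
    sph (fun w => (f w)⁻¹) z = sph f z := by
  unfold sph
  rw [(hf.hasDerivAt.fun_inv hz).deriv]
  have : ‖f z‖ ≠ 0 := by simpa
  simp only [norm_div, norm_neg, norm_pow, norm_inv]
  field_simp
  ring

theorem sph_le_of_norm_le {f : ℂ → ℂ} {x : ℂ} {r M : ℝ} (hr : 0 < r)
    (hf : DifferentiableOn ℂ f (ball x r)) (hM : ∀ z ∈ ball x r, ‖f z‖ ≤ M) :
    sph f x ≤ 2 * M / r :=
  (sph_le_norm_deriv f x).trans (norm_deriv_le_of_ball hr hf hM)

theorem sph_le_of_le_norm {f : ℂ → ℂ} {x : ℂ} {r m : ℝ} (hr : 0 < r) (hm : 0 < m)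
    (hf : DifferentiableOn ℂ f (ball x r)) (hM : ∀ z ∈ ball x r, m ≤ ‖f z‖) :
    sph f x ≤ 2 * m⁻¹ / r := by
  have hne : ∀ z ∈ ball x r, f z ≠ 0 := fun z hz h => by
    have := hM z hz; rw [h, norm_zero] at this; linarith
  rw [← sph_inv (hf.differentiableAt (ball_mem_nhds x hr)) (hne x (mem_ball_self hr))]
  refine sph_le_of_norm_le hr (hf.fun_inv hne) fun z hz => ?_
  rw [norm_inv]
  exact inv_anti₀ hm (hM z hz)

theorem sph_comp_affine (f : ℂ → ℂ) (c a ζ : ℂ) :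
    sph (fun z => f (c + a * z)) ζ = ‖a‖ * sph f (c + a * ζ) := by
  unfold sph
  have : deriv (fun z => f (c + a * z)) ζ = a * deriv f (c + a * ζ) := by
    have := deriv_comp_mul_left a (fun w => f (c + w)) ζ
    rw [deriv_comp_const_add] at this
    simpa using this
  rw [this, norm_mul, mul_div_assoc]

/-- The third stereographic coordinate of `f` is Lipschitz with constant a bound of the spherical
derivative. -/
theorem abs_inv_one_add_sq_sub_le {f : ℂ → ℂ} {s : Set ℂ} {C : ℝ} (hs : Convex ℝ s)
    (ho : IsOpen s) (hf : DifferentiableOn ℂ f s) (hC : ∀ z ∈ s, sph f z ≤ C) {z w : ℂ}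
    (hz : z ∈ s) (hw : w ∈ s) :
    |(1 + ‖f z‖ ^ 2)⁻¹ - (1 + ‖f w‖ ^ 2)⁻¹| ≤ C * ‖z - w‖ := by
  have key : ∀ x ∈ s, ∃ L : ℂ →L[ℝ] ℝ,
      HasFDerivAt (fun y => (1 + ‖f y‖ ^ 2)⁻¹) L x ∧ ‖L‖ ≤ C := by
    intro x hx
    have hd : HasFDerivAt f ((deriv f x) • (1 : ℂ →L[ℝ] ℂ)) x :=
      (hf.differentiableAt (ho.mem_nhds hx)).hasDerivAt.complexToReal_fderiv
    have h1 := (hd.norm_sq.const_add 1)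
    have hpos : 0 < 1 + ‖f x‖ ^ 2 := by positivity
    have h2 := (hasDerivAt_inv hpos.ne').comp_hasFDerivAt x h1
    refine ⟨_, h2, ?_⟩
    refine le_trans ?_ (hC x hx)
    refine ContinuousLinearMap.opNorm_le_bound _ (sph_nonneg f x) fun v => ?_
    simp only [_root_.smul_apply, ContinuousLinearMap.comp_apply, smul_eq_mul,
      one_apply_eq_self, innerSL_apply_apply, norm_mul, norm_neg, norm_inv, norm_pow,
      Real.norm_eq_abs, nsmul_eq_mul]
    have h3 := abs_real_inner_le_norm (f x) (deriv f x * v)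
    rw [norm_mul] at h3
    rw [abs_of_pos hpos, abs_of_nonneg (by norm_num : (0:ℝ) ≤ ((2:ℕ):ℝ))]
    unfold sph
    -- This absorbs the factor 2‖f‖ of the differential and leaves one power of 1 + ‖f‖² in the
    -- denominator.
    have h4 : 2 * ‖f x‖ ≤ 1 + ‖f x‖ ^ 2 := by nlinarith [sq_nonneg (‖f x‖ - 1)]
    calc ((1 + ‖f x‖ ^ 2) ^ 2)⁻¹ * (((2:ℕ):ℝ) * |inner ℝ (f x) (deriv f x * v)|)
        ≤ ((1 + ‖f x‖ ^ 2) ^ 2)⁻¹ * (2 * (‖f x‖ * (‖deriv f x‖ * ‖v‖))) := by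
          push_cast; gcongr
      _ = ((1 + ‖f x‖ ^ 2) ^ 2)⁻¹ * ((2 * ‖f x‖) * (‖deriv f x‖ * ‖v‖)) := by ring
      _ ≤ ((1 + ‖f x‖ ^ 2) ^ 2)⁻¹ * ((1 + ‖f x‖ ^ 2) * (‖deriv f x‖ * ‖v‖)) := by gcongr
      _ = _ := by field_simp
  choose! L hL hLC using key
  have := hs.norm_image_sub_le_of_norm_hasFDerivWithin_le (𝕜 := ℝ)
    (fun x hx => (hL x hx).hasFDerivWithinAt) hLC hw hz
  simpa [Real.norm_eq_abs] using this

/-! ### Hurwitz, Vitali and Marty -/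

/-- Hurwitz: a zero of a locally uniform limit of zero-free holomorphic functions is not
isolated. -/
theorem eventually_eq_zero_of_tendsto_ne_zero {F : ℕ → ℂ → ℂ} {G : ℂ → ℂ} {x : ℂ} {r : ℝ}
    (hr : 0 < r)
    (hF : ∀ᶠ n in atTop, DifferentiableOn ℂ (F n) (ball x r) ∧ ∀ z ∈ ball x r, F n z ≠ 0)
    (hlim : TendstoLocallyUniformlyOn F G atTop (ball x r)) (hx : G x = 0) :
    ∀ᶠ z in 𝓝 x, G z = 0 := by
  have hG : DifferentiableOn ℂ G (ball x r) :=
    hlim.differentiableOn (hF.mono fun n h => h.1) isOpen_ball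
  have hGa : AnalyticAt ℂ G x := hG.analyticAt (ball_mem_nhds x hr)
  rcases hGa.eventually_eq_zero_or_eventually_ne_zero with h | h
  · exact h
  exfalso
  rw [eventually_nhdsWithin_iff, Metric.eventually_nhds_iff] at h
  obtain ⟨ε, hε, h⟩ := h
  set s := min ε r / 2 with hs
  have hs0 : 0 < s := by positivity
  have hsε : s < ε := by have := min_le_left ε r; have := lt_min hε hr; linarith
  have hsr : s < r := by have := min_le_right ε r; have := lt_min hε hr; linarith
  have hsub : closedBall x s ⊆ ball x r := closedBall_subset_ball hsr
  have hcont : ContinuousOn (fun z => ‖G z‖) (sphere x s) :=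
    (hG.continuousOn.mono (sphere_subset_closedBall.trans hsub)).norm
  obtain ⟨z₀, hz₀, hmin⟩ := (isCompact_sphere x s).exists_isMinOn
    (NormedSpace.sphere_nonempty.2 hs0.le) hcont
  have hpos : 0 < ‖G z₀‖ := by
    rw [norm_pos_iff]
    refine h ?_ ?_
    · rw [mem_sphere.1 hz₀]; exact hsε
    · rintro rfl; simp at hz₀; linarith
  have hun : TendstoUniformlyOn F G atTop (closedBall x s) :=
    (tendstoLocallyUniformlyOn_iff_tendstoUniformlyOn_of_compact (isCompact_closedBall x s)).1
      (hlim.mono hsub)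
  rw [Metric.tendstoUniformlyOn_iff] at hun
  obtain ⟨n, ⟨hd, hne⟩, hn⟩ := (hF.and (hun (‖G z₀‖ / 2) (by positivity))).exists
  -- The maximum principle for 1 / F n carries the lower bound on the circle to the centre, where F
  -- n is close to G x = 0.
  have hbd : ∀ z ∈ closure (ball x s), ‖(F n z)⁻¹‖ ≤ (‖G z₀‖ / 2)⁻¹ := by
    intro z hz
    refine Complex.norm_le_of_forall_mem_frontier_norm_le (f := fun z => (F n z)⁻¹) isBounded_ball
      ?_ ?_ hz
    · refine DifferentiableOn.diffContOnCl ?_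
      rw [closure_ball _ hs0.ne']
      exact (hd.fun_inv hne).mono hsub
    · intro w hw
      rw [frontier_ball _ hs0.ne'] at hw
      rw [norm_inv]
      refine inv_anti₀ (by positivity) ?_
      have h1 := hn w (sphere_subset_closedBall hw)
      have h2 : ‖G z₀‖ ≤ ‖G w‖ := hmin hw
      rw [dist_eq_norm] at h1
      have := norm_sub_norm_le (G w) (F n w)
      linarith
  have h1 := hbd x (subset_closure (mem_ball_self hs0))
  have h2 := hn x (mem_closedBall_self hs0.le)
  rw [hx, dist_eq_norm, zero_sub, norm_neg] at h2
  rw [norm_inv] at h1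
  have h3 : 0 < ‖F n x‖ := norm_pos_iff.2 (hne x (mem_ball_self hr))
  have := (inv_le_inv₀ h3 (by positivity)).1 h1
  linarith

/-- Vitali: a bounded sequence of holomorphic functions which converges on a dense set converges
locally uniformly. -/
theorem exists_tendstoUniformlyOn_of_dense {F : ℕ → ℂ → ℂ} {x : ℂ} {r M : ℝ} {D : Set ℂ}
    (hr : 0 < r) (hD : Dense D)
    (hF : ∀ᶠ n in atTop, DifferentiableOn ℂ (F n) (ball x r) ∧ ∀ z ∈ ball x r, ‖F n z‖ ≤ M)
    (hlim : ∀ d ∈ D, d ∈ ball x r → ∃ y, Tendsto (fun n => F n d) atTop (𝓝 y)) :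
    ∃ G, TendstoUniformlyOn F G atTop (ball x (r / 2)) := by
  have hM : 0 ≤ M := by
    obtain ⟨n, -, hn⟩ := hF.exists
    exact (norm_nonneg _).trans (hn x (mem_ball_self hr))
  -- Cauchy's estimate on discs of radius r / 2 gives 4M / r; the added 1 keeps L positive when M =
  -- 0.
  set L := 4 * M / r + 1 with hLdef
  have hL : 0 < L := by positivity
  have hlip : ∀ᶠ n in atTop, ∀ z ∈ ball x (r / 2), ∀ w ∈ ball x (r / 2),
      ‖F n z - F n w‖ ≤ L * ‖z - w‖ := by
    filter_upwards [hF] with n ⟨hd, hb⟩ z hz w hw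
    have hsub : ∀ y ∈ ball x (r / 2), ball y (r / 2) ⊆ ball x r := fun y hy =>
      ball_subset_ball' (by rw [mem_ball] at hy; linarith)
    refine (convex_ball x (r / 2)).norm_image_sub_le_of_norm_deriv_le (𝕜 := ℂ) (fun y hy => ?_)
      (fun y hy => ?_) hw hz
    · exact hd.differentiableAt (isOpen_ball.mem_nhds (ball_subset_ball (by linarith) hy))
    · have := norm_deriv_le_of_ball (by positivity) (hd.mono (hsub y hy))
        (fun z hz => hb z (hsub y hy hz))
      refine this.trans ?_
      rw [hLdef]
      have : 2 * M / (r / 2) = 4 * M / r := by field_simp; ring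
      linarith
  have hcauchy : UniformCauchySeqOn F atTop (ball x (r / 2)) := by
    rw [Metric.uniformCauchySeqOn_iff]
    intro ε hε
    set δ := ε / (8 * L) with hδ
    have hδ0 : 0 < δ := by positivity
    obtain ⟨t, hts, htf, hcov⟩ := finite_approx_of_totallyBounded
      (s := ball x (r / 2)) ((isCompact_closedBall x (r / 2)).totallyBounded.subset
        ball_subset_closedBall) δ hδ0
    have hex : ∀ y ∈ t, ∃ d ∈ D, d ∈ ball x (r / 2) ∧ dist y d < δ := by
      intro y hy
      obtain ⟨d, hd, hdD⟩ := hD.inter_open_nonempty (ball x (r / 2) ∩ ball y δ)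
        (isOpen_ball.inter isOpen_ball) ⟨y, hts hy, mem_ball_self hδ0⟩
      exact ⟨d, hdD, hd.1, by rw [dist_comm]; exact hd.2⟩
    choose! d hdD hdB hdist using hex
    have hc : ∀ y ∈ t, ∃ N, ∀ m ≥ N, ∀ n ≥ N, dist (F m (d y)) (F n (d y)) < ε / 4 := by
      intro y hy
      obtain ⟨v, hv⟩ := hlim (d y) (hdD y hy) (ball_subset_ball (by linarith) (hdB y hy))
      exact Metric.cauchySeq_iff.1 hv.cauchySeq _ (by positivity)
    choose! N hN using hc
    obtain ⟨N₀, hN₀⟩ := eventually_atTop.1 hlip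
    obtain ⟨N₁, hN₁⟩ := (htf.image N).bddAbove
    refine ⟨max N₀ N₁, fun m hm n hn z hz => ?_⟩
    obtain ⟨y, hy, hzy⟩ := mem_iUnion₂.1 (hcov hz)
    have hzd : ‖z - d y‖ ≤ 2 * δ := by
      rw [← dist_eq_norm]
      have := dist_triangle z y (d y)
      have := hdist y hy
      have := mem_ball.1 hzy
      linarith
    have hNy : N y ≤ N₁ := hN₁ (mem_image_of_mem N hy)
    have h1 := hN₀ m (le_of_max_le_left hm) z hz _ (hdB y hy)
    have h2 := hN₀ n (le_of_max_le_left hn) z hz _ (hdB y hy)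
    have h3 := hN y hy m (hNy.trans (le_of_max_le_right hm)) n (hNy.trans (le_of_max_le_right hn))
    rw [← dist_eq_norm] at h1 h2
    have h4 : L * ‖z - d y‖ ≤ ε / 4 := by
      calc L * ‖z - d y‖ ≤ L * (2 * δ) := by gcongr
        _ = ε / 4 := by rw [hδ]; field_simp; ring
    have h5 := dist_triangle4 (F m z) (F m (d y)) (F n (d y)) (F n z)
    rw [dist_comm (F n (d y))] at h5
    linarith
  have hpt : ∀ z ∈ ball x (r / 2), ∃ y, Tendsto (fun n => F n z) atTop (𝓝 y) := fun z hz =>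
    cauchySeq_tendsto_of_complete (hcauchy.cauchySeq hz)
  choose! G hG using hpt
  exact ⟨G, hcauchy.tendstoUniformlyOn_of_tendsto hG⟩

/-- Stereographic coordinates are bounded, so compactness of a countable product replaces a diagonal
argument. The value ∞ corresponds to a = 0, b = 0. -/
theorem exists_subseq_tendsto_stereographic (F : ℕ → ℂ → ℂ) (d : ℕ → ℂ) :
    ∃ φ : ℕ → ℕ, StrictMono φ ∧ ∃ (a : ℕ → ℂ) (b : ℕ → ℝ), ∀ k,
      Tendsto (fun n => (1 + ‖F (φ n) (d k)‖ ^ 2)⁻¹ • F (φ n) (d k)) atTop (𝓝 (a k)) ∧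
      Tendsto (fun n => (1 + ‖F (φ n) (d k)‖ ^ 2)⁻¹) atTop (𝓝 (b k)) := by
  have hcpt : IsCompact (Set.pi univ fun _ : ℕ => closedBall (0 : ℂ × ℝ) 1) :=
    isCompact_univ_pi fun _ => isCompact_closedBall _ _
  obtain ⟨y, -, φ, hφ, hy⟩ := hcpt.tendsto_subseq
    (x := fun n k => ((1 + ‖F n (d k)‖ ^ 2)⁻¹ • F n (d k), (1 + ‖F n (d k)‖ ^ 2)⁻¹)) (by
      intro n k _
      set w := F n (d k)
      have h0 : 0 < 1 + ‖w‖ ^ 2 := by positivity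
      rw [mem_closedBall_zero_iff, Prod.norm_def, max_le_iff]
      constructor
      · rw [norm_smul, Real.norm_of_nonneg (by positivity), inv_mul_le_iff₀ h0]
        nlinarith [sq_nonneg (‖w‖ - 1)]
      · rw [Real.norm_of_nonneg (by positivity)]
        exact inv_le_one_of_one_le₀ (by nlinarith [sq_nonneg ‖w‖]))
  rw [tendsto_pi_nhds] at hy
  refine ⟨φ, hφ, fun k => (y k).1, fun k => (y k).2, fun k => ⟨?_, ?_⟩⟩
  · exact (continuous_fst.tendsto _).comp (hy k)
  · exact (continuous_snd.tendsto _).comp (hy k)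

/-- Local form of Marty's theorem for a sequence whose stereographic projections converge on a dense
set. -/
theorem tendstoUniformlyOn_or_tendsto_infty {f : ℕ → ℂ → ℂ} {d : ℕ → ℂ} (hd : DenseRange d)
    {a : ℕ → ℂ} {b : ℕ → ℝ}
    (ha : ∀ k, Tendsto (fun n => (1 + ‖f n (d k)‖ ^ 2)⁻¹ • f n (d k)) atTop (𝓝 (a k)))
    (hb : ∀ k, Tendsto (fun n => (1 + ‖f n (d k)‖ ^ 2)⁻¹) atTop (𝓝 (b k)))
    {x : ℂ} {r C : ℝ} (hr : 0 < r)
    (hf : ∀ᶠ n in atTop, DifferentiableOn ℂ (f n) (ball x r) ∧ ∀ z ∈ ball x r, sph (f n) z ≤ C) :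
    (∃ s > 0, ∃ G, TendstoUniformlyOn f G atTop (ball x s)) ∨
      ∃ s > 0, ∀ M : ℝ, ∀ᶠ n in atTop, ∀ z ∈ ball x s, M < ‖f n z‖ := by
  have hC : 0 ≤ C := by
    obtain ⟨n, -, hn⟩ := hf.exists
    exact (sph_nonneg _ _).trans (hn x (mem_ball_self hr))
  -- Points of the disc are less than 2ρ apart, so (1 + ‖f n‖²)⁻¹ varies by at most 2ρC ≤ 1/10 on
  -- it.
  set ρ := min r (1 / (20 * (C + 1))) with hρ
  have hρ0 : 0 < ρ := by positivity
  have hρC : C * (2 * ρ) ≤ 1 / 10 := by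
    have : ρ ≤ 1 / (20 * (C + 1)) := min_le_right _ _
    calc C * (2 * ρ) ≤ (C + 1) * (2 * (1 / (20 * (C + 1)))) := by gcongr; linarith
      _ = 1 / 10 := by field_simp; norm_num
  have hsub : ball x ρ ⊆ ball x r := ball_subset_ball (min_le_left _ _)
  have hvar : ∀ᶠ n in atTop, ∀ z ∈ ball x ρ, ∀ w ∈ ball x ρ,
      |(1 + ‖f n z‖ ^ 2)⁻¹ - (1 + ‖f n w‖ ^ 2)⁻¹| ≤ 1 / 10 := by
    filter_upwards [hf] with n ⟨h1, h2⟩ z hz w hw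
    refine (abs_inv_one_add_sq_sub_le (convex_ball x r) isOpen_ball h1 h2 (hsub hz)
      (hsub hw)).trans (le_trans ?_ hρC)
    gcongr
    rw [← dist_eq_norm]
    have := dist_triangle_right z w x
    have := mem_ball.1 hz
    have := mem_ball.1 hw
    linarith
  obtain ⟨_, ⟨⟨k, rfl⟩, hk⟩⟩ := hd.inter_open_nonempty (ball x ρ) isOpen_ball
    ⟨x, mem_ball_self hρ0⟩ |>.imp fun y h => And.intro h.2 h.1
  -- One sampled value decides for the whole disc: either ‖f n‖ ≤ 2 there, and Vitali applies to f
  -- n, or ‖f n‖ ≥ 1/2, and it applies to 1 / f n.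
  rcases le_total (1 / 2) (b k) with ht | ht
  · have hs : ∀ᶠ n in atTop, ∀ z ∈ ball x ρ, 3 / 10 ≤ (1 + ‖f n z‖ ^ 2)⁻¹ := by
      filter_upwards [hvar, (hb k).eventually_const_lt (show 4 / 10 < b k by linarith)]
        with n h1 h2 z hz
      have := abs_le.1 (h1 z hz _ hk)
      linarith
    left
    obtain ⟨G, hG⟩ := exists_tendstoUniformlyOn_of_dense (F := f) (M := 2) hρ0 hd (x := x) (by
      filter_upwards [hf, hs] with n h1 h2
      refine ⟨h1.1.mono hsub, fun z hz => ?_⟩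
      have h3 := h2 z hz
      have h4 : 1 + ‖f n z‖ ^ 2 ≤ (3 / 10)⁻¹ := by
        rw [← inv_inv (1 + ‖f n z‖ ^ 2)]
        exact inv_anti₀ (by norm_num) h3
      norm_num at h4
      nlinarith [norm_nonneg (f n z)]) (by
      rintro _ ⟨j, rfl⟩ hj
      have hbj : 3 / 10 ≤ b j := ge_of_tendsto (hb j) (hs.mono fun n h => h _ hj)
      refine ⟨(b j)⁻¹ • a j, (((hb j).inv₀ (by linarith)).smul (ha j)).congr fun n => ?_⟩
      rw [smul_smul, inv_mul_cancel₀ (by positivity), one_smul])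
    exact ⟨ρ / 2, by positivity, G, hG⟩
  · have hs : ∀ᶠ n in atTop, ∀ z ∈ ball x ρ, (1 + ‖f n z‖ ^ 2)⁻¹ ≤ 7 / 10 := by
      filter_upwards [hvar, (hb k).eventually_lt_const (show b k < 6 / 10 by linarith)]
        with n h1 h2 z hz
      have := abs_le.1 (h1 z hz _ hk)
      linarith
    have hbig : ∀ᶠ n in atTop, ∀ z ∈ ball x ρ, 1 / 2 ≤ ‖f n z‖ := by
      filter_upwards [hs] with n h z hz
      have h3 := inv_anti₀ (by positivity) (h z hz)
      rw [inv_inv] at h3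
      norm_num at h3
      nlinarith [norm_nonneg (f n z)]
    have hne : ∀ᶠ n in atTop, ∀ z ∈ ball x ρ, f n z ≠ 0 := by
      filter_upwards [hbig] with n h z hz h0
      have := h z hz
      rw [h0, norm_zero] at this
      norm_num at this
    obtain ⟨H, hH⟩ := exists_tendstoUniformlyOn_of_dense (F := fun n z => (f n z)⁻¹) (M := 2) hρ0
      hd (x := x) (by
      filter_upwards [hf, hbig, hne] with n h1 h2 h3
      refine ⟨(h1.1.mono hsub).fun_inv h3, fun z hz => ?_⟩
      rw [norm_inv]
      have := inv_anti₀ (by norm_num) (h2 z hz)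
      norm_num at this
      exact this) (by
      rintro _ ⟨j, rfl⟩ hj
      have hbj : b j ≤ 7 / 10 := le_of_tendsto (hb j) (hs.mono fun n h => h _ hj)
      -- In stereographic coordinates 1/w = conj(a) / (1 - b), since 1 - b = ‖w‖² / (1 + ‖w‖²).
      refine ⟨(1 - b j)⁻¹ • (starRingEnd ℂ) (a j), Tendsto.congr' ?_
        (((hb j).const_sub 1).inv₀ (by linarith) |>.smul
          ((Complex.continuous_conj.tendsto _).comp (ha j)))⟩
      filter_upwards [hne] with n hn
      have h0 := hn _ hj
      set w := f n (d j)
      have hw : ‖w‖ ≠ 0 := by simpa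
      have h1 : (1 - (1 + ‖w‖ ^ 2)⁻¹)⁻¹ * (1 + ‖w‖ ^ 2)⁻¹ = (‖w‖ ^ 2)⁻¹ := by
        have h2 : 1 + ‖w‖ ^ 2 ≠ 0 := by positivity
        have h3 : 1 - (1 + ‖w‖ ^ 2)⁻¹ = ‖w‖ ^ 2 * (1 + ‖w‖ ^ 2)⁻¹ := by field_simp; ring
        rw [h3]; field_simp
      simp only [Function.comp, Complex.real_smul, map_mul, Complex.conj_ofReal]
      rw [← mul_assoc, ← Complex.ofReal_mul, h1, Complex.inv_def, Complex.normSq_eq_norm_sq]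
      ring)
    have hlu := hH.tendstoLocallyUniformlyOn
    have hHd : DifferentiableOn ℂ H (ball x (ρ / 2)) := by
      refine hlu.differentiableOn ?_ isOpen_ball
      filter_upwards [hf, hne] with n h1 h3
      exact ((h1.1.mono hsub).fun_inv h3).mono (ball_subset_ball (by linarith))
    -- By Hurwitz a zero of the limit H of the reciprocals makes H vanish near x, so f n → ∞.
    -- Otherwise f n is bounded near x.
    by_cases h0 : H x = 0
    · right
      have hz := eventually_eq_zero_of_tendsto_ne_zero (half_pos hρ0) (by
        filter_upwards [hf, hne] with n h1 h3
        exact ⟨((h1.1.mono hsub).fun_inv h3).mono (ball_subset_ball (by linarith)),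
          fun z hz => inv_ne_zero (h3 z (ball_subset_ball (by linarith) hz))⟩) hlu h0
      obtain ⟨s, hs0, hs1⟩ := Metric.eventually_nhds_iff_ball.1 hz
      refine ⟨min s (ρ / 2), by positivity, fun M => ?_⟩
      filter_upwards [Metric.tendstoUniformlyOn_iff.1 hH (1 / (|M| + 1)) (by positivity), hne]
        with n h1 h3 z hz
      have hz1 := ball_subset_ball (min_le_right _ _) hz
      have hz2 := h1 z hz1
      have hz3 : 0 < ‖f n z‖ := norm_pos_iff.2 (h3 z (ball_subset_ball (by linarith) hz1))
      rw [hs1 z (ball_subset_ball (min_le_left _ _) hz), dist_eq_norm, zero_sub, norm_neg,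
        norm_inv, one_div, inv_lt_inv₀ hz3 (by positivity)] at hz2
      have := le_abs_self M
      linarith
    · left
      have hcont : ContinuousAt H x := (hHd.continuousOn).continuousAt (ball_mem_nhds x (by positivity))
      have hpos : 0 < ‖H x‖ := norm_pos_iff.2 h0
      have hev : ∀ᶠ z in 𝓝 x, ‖H x‖ / 2 < ‖H z‖ :=
        hcont.norm.eventually_const_lt (by linarith)
      obtain ⟨s, hs0, hs1⟩ := Metric.eventually_nhds_iff_ball.1 hev
      set s' := min s (ρ / 2)
      have hs' : 0 < s' := by positivity
      have hsub' : ball x s' ⊆ ball x (ρ / 2) := ball_subset_ball (min_le_right _ _)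
      have hsub2 : ball x (ρ / 2) ⊆ ball x ρ := ball_subset_ball (by linarith)
      obtain ⟨G, hG⟩ := exists_tendstoUniformlyOn_of_dense (F := f) (M := (‖H x‖ / 4)⁻¹) hs' hd
        (x := x) (by
        filter_upwards [hf, hne, Metric.tendstoUniformlyOn_iff.1 hH (‖H x‖ / 4) (by positivity)]
          with n h1 h3 h4
        refine ⟨h1.1.mono (hsub'.trans (hsub2.trans hsub)), fun z hz => ?_⟩
        have h5 := h4 z (hsub' hz)
        have h6 := hs1 z (ball_subset_ball (min_le_left _ _) hz)
        rw [dist_eq_norm] at h5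
        have h7 := norm_sub_norm_le (H z) (f n z)⁻¹
        rw [← inv_inv (f n z), norm_inv]
        exact inv_anti₀ (by positivity) (by linarith)) (by
        intro z _ hz
        have h6 := hs1 z (ball_subset_ball (min_le_left _ _) hz)
        have : H z ≠ 0 := by rw [← norm_pos_iff]; linarith
        refine ⟨(H z)⁻¹, ((hH.tendsto_at (hsub' hz)).inv₀ this).congr fun n => ?_⟩
        rw [inv_inv])
      exact ⟨s' / 2, by positivity, G, hG⟩

/-- Marty's theorem: a sequence of functions which is eventually holomorphic with locally bounded
spherical derivative on a domain has a subsequence converging locally uniformly to a finite function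
or to `∞`. -/
theorem exists_subseq_of_sph_bounded {U : Set ℂ} (hc : IsPreconnected U)
    {F : ℕ → ℂ → ℂ} (hF : ∀ x ∈ U, ∃ r > 0, ∃ C, ∀ᶠ n in atTop,
      DifferentiableOn ℂ (F n) (ball x r) ∧ ∀ z ∈ ball x r, sph (F n) z ≤ C) :
    ∃ φ : ℕ → ℕ, StrictMono φ ∧
      ((∃ G : ℂ → ℂ, TendstoLocallyUniformlyOn (fun n => F (φ n)) G atTop U) ∨
        TendstoInftyLocallyUniformlyOn (fun n => F (φ n)) U) := by
  obtain ⟨φ, hφ, a, b, hab⟩ := exists_subseq_tendsto_stereographic F (TopologicalSpace.denseSeq ℂ)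
  refine ⟨φ, hφ, ?_⟩
  set f := fun n => F (φ n) with hf
  have hloc : ∀ x ∈ U, (∃ s > 0, ∃ G, TendstoUniformlyOn f G atTop (ball x s)) ∨
      ∃ s > 0, ∀ M : ℝ, ∀ᶠ n in atTop, ∀ z ∈ ball x s, M < ‖f n z‖ := by
    intro x hx
    obtain ⟨r, hr, C, h⟩ := hF x hx
    exact tendstoUniformlyOn_or_tendsto_infty (TopologicalSpace.denseRange_denseSeq ℂ)
      (fun k => (hab k).1) (fun k => (hab k).2) hr (hφ.tendsto_atTop.eventually h)
  -- Finite and infinite local convergence are open and mutually exclusive, so connectedness selects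
  -- one of them.
  set A := {x | ∃ s > 0, ∃ G, TendstoUniformlyOn f G atTop (ball x s)}
  set B := {x | ∃ s > 0, ∀ M : ℝ, ∀ᶠ n in atTop, ∀ z ∈ ball x s, M < ‖f n z‖}
  have hshrink : ∀ {x y : ℂ} {s : ℝ}, y ∈ ball x s → ball y (s - dist y x) ⊆ ball x s :=
    fun h => ball_subset_ball' (by linarith)
  have hA : IsOpen A := Metric.isOpen_iff.2 fun x ⟨s, hs, G, hG⟩ =>
    ⟨s, hs, fun y hy => ⟨s - dist y x, sub_pos.2 (mem_ball.1 hy), G, hG.mono (hshrink hy)⟩⟩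
  have hB : IsOpen B := Metric.isOpen_iff.2 fun x ⟨s, hs, hG⟩ =>
    ⟨s, hs, fun y hy => ⟨s - dist y x, sub_pos.2 (mem_ball.1 hy), fun M =>
      (hG M).mono fun n h z hz => h z (hshrink hy hz)⟩⟩
  have hdisj : Disjoint A B := by
    rw [Set.disjoint_left]
    rintro x ⟨s, hs, G, hG⟩ ⟨t, ht, hB⟩
    have h1 := (hG.tendsto_at (mem_ball_self hs)).norm.eventually_lt_const
      (show ‖G x‖ < ‖G x‖ + 1 by linarith)
    obtain ⟨n, h2, h3⟩ := (h1.and (hB (‖G x‖ + 1))).exists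
    have := h3 x (mem_ball_self ht)
    linarith
  rcases hc.subset_or_subset hA hB hdisj hloc with h | h
  · left
    have hpt : ∀ x ∈ U, ∃ y, Tendsto (fun n => f n x) atTop (𝓝 y) := by
      intro x hx
      obtain ⟨s, hs, G, hG⟩ := h hx
      exact ⟨_, hG.tendsto_at (mem_ball_self hs)⟩
    choose! G hG using hpt
    refine ⟨G, Metric.tendstoLocallyUniformlyOn_iff.2 fun ε hε x hx => ?_⟩
    obtain ⟨s, hs, G', hG'⟩ := h hx
    refine ⟨ball x s ∩ U, ?_, ?_⟩
    · exact inter_mem (mem_nhdsWithin_of_mem_nhds (ball_mem_nhds x hs)) self_mem_nhdsWithin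
    · filter_upwards [Metric.tendstoUniformlyOn_iff.1 hG' ε hε] with n hn y hy
      rw [tendsto_nhds_unique (hG y hy.2) (hG'.tendsto_at hy.1)]
      exact hn y hy.1
  · right
    intro K hK hKc M
    choose! s hs hsM using fun x (hx : x ∈ U) => h hx
    obtain ⟨t, htK, ht⟩ := hKc.elim_nhds_subcover (fun x => ball x (s x))
      fun x hx => ball_mem_nhds x (hs x (hK hx))
    have : ∀ᶠ n in atTop, ∀ x ∈ t, ∀ z ∈ ball x (s x), M < ‖f n z‖ :=
      (Filter.eventually_all_finset t).2 fun x hx => hsM x (hK (htK x hx)) M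
    filter_upwards [this] with n hn z hz
    obtain ⟨x, hx, hxz⟩ := mem_iUnion₂.1 (ht hz)
    exact hn x hx z hxz

/-! ### Entire limits and Zalcman's lemma -/

theorem tendsto_sph {F : ℕ → ℂ → ℂ} {G : ℂ → ℂ} {U : Set ℂ} (hU : IsOpen U)
    (hF : ∀ᶠ n in atTop, DifferentiableOn ℂ (F n) U)
    (hlim : TendstoLocallyUniformlyOn F G atTop U) {x : ℂ} (hx : x ∈ U) :
    Tendsto (fun n => sph (F n) x) atTop (𝓝 (sph G x)) := by
  have h1 := ((hlim.deriv hF hU).tendsto_at hx).norm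
  have h2 := ((hlim.tendsto_at hx).norm.pow 2).const_add 1
  exact h1.div h2 (by positivity)

/-- A sequence, eventually holomorphic on any given disc, whose spherical derivatives are
asymptotically at most `1`, with equality at `0`, has a nonconstant entire limit. -/
theorem exists_entire_limit {F : ℕ → ℂ → ℂ}
    (hF : ∀ R > 0, ∀ ε > 0, ∀ᶠ n in atTop,
      DifferentiableOn ℂ (F n) (ball 0 R) ∧ ∀ z ∈ ball 0 R, sph (F n) z ≤ 1 + ε)
    (h0 : ∀ᶠ n in atTop, sph (F n) 0 = 1) :
    ∃ φ : ℕ → ℕ, StrictMono φ ∧ ∃ G : ℂ → ℂ, Differentiable ℂ G ∧ (∀ z, sph G z ≤ 1) ∧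
      sph G 0 = 1 ∧ TendstoLocallyUniformlyOn (fun n => F (φ n)) G atTop univ := by
  obtain ⟨φ, hφ, h⟩ := exists_subseq_of_sph_bounded (U := univ) isPreconnected_univ (F := F)
    fun x _ => ⟨1, one_pos, 1 + 1, by
      filter_upwards [hF (‖x‖ + 1) (by positivity) 1 one_pos] with n hn
      have hsub : ball x 1 ⊆ ball 0 (‖x‖ + 1) := ball_subset_ball' (by simp [add_comm])
      exact ⟨hn.1.mono hsub, fun z hz => hn.2 z (hsub hz)⟩⟩
  have hφF : ∀ R > 0, ∀ ε > 0, ∀ᶠ n in atTop, DifferentiableOn ℂ (F (φ n)) (ball 0 R) ∧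
      ∀ z ∈ ball 0 R, sph (F (φ n)) z ≤ 1 + ε := fun R hR ε hε =>
    hφ.tendsto_atTop.eventually (hF R hR ε hε)
  have hφ0 := hφ.tendsto_atTop.eventually h0
  refine ⟨φ, hφ, ?_⟩
  rcases h with ⟨G, hG⟩ | h
  · have hGR : ∀ R, TendstoLocallyUniformlyOn (fun n => F (φ n)) G atTop (ball 0 R) :=
      fun R => hG.mono (subset_univ _)
    have hdiff : Differentiable ℂ G := fun z =>
      ((hGR (‖z‖ + 1)).differentiableOn ((hφF (‖z‖ + 1) (by positivity) 1 one_pos).mono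
        fun n h => h.1) isOpen_ball).differentiableAt (isOpen_ball.mem_nhds (by simp))
    have hsph : ∀ z, Tendsto (fun n => sph (F (φ n)) z) atTop (𝓝 (sph G z)) := fun z =>
      tendsto_sph isOpen_ball ((hφF (‖z‖ + 1) (by positivity) 1 one_pos).mono
        fun n h => h.1) (hGR (‖z‖ + 1)) (by simp)
    refine ⟨G, hdiff, fun z => ?_, ?_, hG⟩
    · refine le_of_forall_pos_le_add fun ε hε => le_of_tendsto (hsph z) ?_
      filter_upwards [hφF (‖z‖ + 1) (by positivity) ε hε] with n hn
      exact hn.2 z (by simp)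
    · exact tendsto_nhds_unique (hsph 0) (tendsto_const_nhds.congr' (hφ0.mono fun n h => h.symm))
  -- Convergence to ∞ would give ‖F‖ > 4 on the unit disc and hence spherical derivative at most 1/2
  -- at 0.
  · exfalso
    obtain ⟨n, ⟨h1, h2⟩, h3⟩ := ((hφ0.and (hφF 1 one_pos 1 one_pos)).and
      (h (closedBall 0 1) (subset_univ _) (isCompact_closedBall _ _) 4)).exists
    have := sph_le_of_le_norm one_pos (by norm_num : (0 : ℝ) < 4) h2.1
      fun z hz => (h3 z (ball_subset_closedBall hz)).le
    rw [h1] at this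
    norm_num at this

theorem eq_const_of_eventually_eq {G : ℂ → ℂ} (hG : Differentiable ℂ G) {z c : ℂ}
    (h : ∀ᶠ w in 𝓝 z, G w = c) : G = fun _ => c :=
  (hG.differentiableOn.analyticOnNhd isOpen_univ).eq_of_eventuallyEq (g := fun _ => c)
    analyticOnNhd_const h

/-- Hurwitz for the value c; the normalisation at 0 excludes a constant limit. -/
theorem forall_ne_of_limit {F : ℕ → ℂ → ℂ} {G : ℂ → ℂ} {c : ℂ} (hG : Differentiable ℂ G)
    (hG0 : sph G 0 = 1)
    (hF : ∀ R > 0, ∀ᶠ n in atTop,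
      DifferentiableOn ℂ (F n) (ball 0 R) ∧ ∀ z ∈ ball 0 R, F n z ≠ c)
    (hlim : TendstoLocallyUniformlyOn F G atTop univ) (z : ℂ) : G z ≠ c := by
  intro hz
  have hsub : ball z 1 ⊆ ball 0 (‖z‖ + 1) := ball_subset_ball' (by simp [add_comm])
  have hlim' : TendstoLocallyUniformlyOn (fun n w => F n w - c) (fun w => G w - c) atTop
      (ball z 1) := by
    rw [Metric.tendstoLocallyUniformlyOn_iff] at hlim ⊢
    intro ε hε x hx
    obtain ⟨t, ht, h⟩ := hlim ε hε x (mem_univ x)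
    refine ⟨t, nhdsWithin_mono x (subset_univ _) ht, h.mono fun n hn y hy => ?_⟩
    simpa using hn y hy
  have := eventually_eq_zero_of_tendsto_ne_zero one_pos (F := fun n w => F n w - c)
    ((hF (‖z‖ + 1) (by positivity)).mono fun n hn =>
      ⟨(hn.1.mono hsub).sub_const c, fun w hw => sub_ne_zero.2 (hn.2 w (hsub hw))⟩)
    hlim' (by simp [hz])
  have hc := eq_const_of_eventually_eq hG (this.mono fun w hw => sub_eq_zero.1 hw)
  rw [hc] at hG0
  simp [sph] at hG0

/-- Zalcman's rescaling lemma. -/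
theorem zalcman {f : ℕ → ℂ → ℂ} {a : ℕ → ℂ}
    (hf : ∀ n, DifferentiableOn ℂ (f n) (ball 0 1)) (ha : ∀ n, ‖a n‖ ≤ 1 / 2)
    (hsph : Tendsto (fun n => sph (f n) (a n)) atTop atTop) :
    ∃ φ : ℕ → ℕ, StrictMono φ ∧ ∃ (z : ℕ → ℂ) (ρ : ℕ → ℝ) (G : ℂ → ℂ),
      (∀ n, ‖z n‖ ≤ 3 / 4) ∧ (∀ᶠ n in atTop, 0 < ρ n) ∧ Tendsto ρ atTop (𝓝 0) ∧
      Differentiable ℂ G ∧ (∀ ζ, sph G ζ ≤ 1) ∧ sph G 0 = 1 ∧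
      TendstoLocallyUniformlyOn (fun n ζ => f (φ n) (z n + ρ n * ζ)) G atTop univ := by
  have hsub : closedBall (0 : ℂ) (3 / 4) ⊆ ball 0 1 := closedBall_subset_ball (by norm_num)
  -- The weight vanishes on the boundary circle, so a maximiser also controls nearby points. At `a
  -- n` the weight is at least 1/4, so the maxima tend to ∞.
  have hmax : ∀ n, ∃ z ∈ closedBall (0 : ℂ) (3 / 4),
      IsMaxOn (fun z => (3 / 4 - ‖z‖) * sph (f n) z) (closedBall 0 (3 / 4)) z := by
    intro n
    refine (isCompact_closedBall _ _).exists_isMaxOn ⟨0, mem_closedBall_self (by norm_num)⟩ ?_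
    have h1 : ContinuousOn (deriv (f n)) (closedBall 0 (3 / 4)) :=
      (((hf n).deriv isOpen_ball).continuousOn).mono hsub
    have h2 : ContinuousOn (f n) (closedBall 0 (3 / 4)) := (hf n).continuousOn.mono hsub
    exact (continuousOn_const.sub continuousOn_id.norm).mul
      (h1.norm.div (continuousOn_const.add (h2.norm.pow 2)) fun z _ => by positivity)
  choose z hz hzmax using hmax
  replace hz : ∀ n, ‖z n‖ ≤ 3 / 4 := fun n => by simpa using hz n
  set M := fun n => (3 / 4 - ‖z n‖) * sph (f n) (z n) with hM
  have hle : ∀ n w, ‖w‖ ≤ 3 / 4 → (3 / 4 - ‖w‖) * sph (f n) w ≤ M n := fun n w hw =>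
    hzmax n (by simpa using hw)
  have hMtop : Tendsto M atTop atTop := by
    refine tendsto_atTop_mono (fun n => ?_) (hsph.const_mul_atTop (show (0 : ℝ) < 1 / 4 by norm_num))
    refine le_trans ?_ (hle n (a n) ((ha n).trans (by norm_num)))
    have := ha n
    have := sph_nonneg (f n) (a n)
    gcongr
    linarith
  set ρ := fun n => (sph (f n) (z n))⁻¹ with hρ
  have hsM : ∀ n, M n ≤ sph (f n) (z n) := fun n => by
    have := sph_nonneg (f n) (z n)
    have := norm_nonneg (z n)
    simp only [hM]
    nlinarith
  have hsphz : Tendsto (fun n => sph (f n) (z n)) atTop atTop := tendsto_atTop_mono hsM hMtop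
  have hρ0 : ∀ᶠ n in atTop, 0 < ρ n := by
    filter_upwards [hsphz.eventually_gt_atTop 0] with n hn
    exact inv_pos.2 hn
  have hρlim : Tendsto ρ atTop (𝓝 0) := tendsto_inv_atTop_zero.comp hsphz
  have hsphg : ∀ n ζ, 0 < ρ n →
      sph (fun ζ => f n (z n + ρ n * ζ)) ζ = ρ n * sph (f n) (z n + ρ n * ζ) := fun n ζ h => by
    rw [sph_comp_affine]
    simp [abs_of_pos h]
  obtain ⟨φ, hφ, G, hG1, hG2, hG3, hG4⟩ := exists_entire_limit
    (F := fun n ζ => f n (z n + ρ n * ζ)) (by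
    intro R hR ε hε
    filter_upwards [hρ0, hMtop.eventually_gt_atTop R,
      hMtop.eventually_ge_atTop (R * (1 + ε) / ε)] with n h1 h2 h3
    have hMρ : ρ n * M n = 3 / 4 - ‖z n‖ := by
      have : sph (f n) (z n) ≠ 0 := by
        intro h; simp [hρ, h] at h1
      simp only [hρ, hM]
      field_simp
    -- On the rescaled disc the weight stays at least ρ(M - R), so maximality bounds the spherical
    -- derivative by M / (M - R), which is at most 1 + ε by `h3`.
    have hin : ∀ ζ ∈ ball (0 : ℂ) R, ‖z n + ρ n * ζ‖ ≤ 3 / 4 - ρ n * (M n - R) := by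
      intro ζ hζ
      rw [mem_ball_zero_iff] at hζ
      calc ‖z n + ρ n * ζ‖ ≤ ‖z n‖ + ρ n * ‖ζ‖ := by
            refine (norm_add_le _ _).trans ?_
            rw [norm_mul, Complex.norm_real, Real.norm_of_nonneg h1.le]
        _ ≤ ‖z n‖ + ρ n * R := by gcongr
        _ = _ := by linarith
    have hMR : 0 < ρ n * (M n - R) := mul_pos h1 (by linarith)
    refine ⟨?_, fun ζ hζ => ?_⟩
    · refine (hf n).comp (Differentiable.differentiableOn (by fun_prop)) fun ζ hζ => ?_
      have := hin ζ hζ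
      rw [mem_ball_zero_iff]
      linarith
    · rw [hsphg n ζ h1]
      have h4 := hin ζ hζ
      have h5 := hle n (z n + ρ n * ζ) (by linarith)
      have h6 := sph_nonneg (f n) (z n + ρ n * ζ)
      have h7 : ρ n * (M n - R) * sph (f n) (z n + ρ n * ζ) ≤ M n := by
        refine le_trans ?_ h5
        gcongr
        linarith
      rw [div_le_iff₀ hε] at h3
      have h8 : M n ≤ (1 + ε) * (M n - R) := by nlinarith
      have h9 : 0 < M n - R := by linarith
      refine le_of_mul_le_mul_right ?_ h9
      calc _ = ρ n * (M n - R) * sph (f n) (z n + ρ n * ζ) := by ring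
        _ ≤ _ := h7
        _ ≤ _ := h8) (by
    filter_upwards [hρ0] with n h
    rw [hsphg n 0 h]
    have : sph (f n) (z n) ≠ 0 := by
      intro h'; simp [hρ, h'] at h
    simp [hρ, inv_mul_cancel₀ this])
  exact ⟨φ, hφ, z ∘ φ, ρ ∘ φ, G, fun n => hz _, hφ.tendsto_atTop.eventually hρ0,
    hρlim.comp hφ.tendsto_atTop, hG1, hG2, hG3, hG4⟩

/-! ### Montel's test and Picard's theorem -/

/-- A primitive L of f'/f with exp L = f at the centre is a logarithm of f on the disc; the root is
exp(L / m). -/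
theorem exists_differentiableOn_pow_eq {f : ℂ → ℂ} {c : ℂ} {r : ℝ} (hr : 0 < r)
    (hf : DifferentiableOn ℂ f (ball c r)) (h0 : ∀ z ∈ ball c r, f z ≠ 0) {m : ℕ} (hm : m ≠ 0) :
    ∃ h : ℂ → ℂ, DifferentiableOn ℂ h (ball c r) ∧ ∀ z ∈ ball c r, h z ^ m = f z := by
  have hc : c ∈ ball c r := mem_ball_self hr
  obtain ⟨L, hL0, hL⟩ := (((hf.deriv isOpen_ball).div hf h0).isExactOn_ball).with_val_at c
    (Complex.log (f c))
  have hLd : DifferentiableOn ℂ L (ball c r) := fun z hz =>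
    (hL z hz).differentiableAt.differentiableWithinAt
  have key : ∀ z ∈ ball c r, f z * Complex.exp (-L z) = 1 := by
    intro z hz
    have hd : ∀ w ∈ ball c r, HasDerivAt (fun z => f z * Complex.exp (-L z)) 0 w := by
      intro w hw
      have h1 := (hf.differentiableAt (isOpen_ball.mem_nhds hw)).hasDerivAt
      have h2 := h1.mul (hL w hw).neg.cexp
      have h3 : deriv f w * Complex.exp ((-L) w) +
          f w * (Complex.exp ((-L) w) * -(deriv f / f) w) = 0 := by
        simp only [Pi.div_apply]
        have := h0 w hw
        field_simp
        ring
      rw [h3] at h2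
      exact h2
    have := isOpen_ball.is_const_of_deriv_eq_zero (convex_ball c r).isPreconnected
      (fun w hw => (hd w hw).differentiableAt.differentiableWithinAt)
      (fun w hw => (hd w hw).deriv) hz hc
    rw [this, hL0, Complex.exp_neg, Complex.exp_log (h0 c hc), mul_inv_cancel₀ (h0 c hc)]
  refine ⟨fun z => Complex.exp (L z / m), (hLd.div_const _).cexp, fun z hz => ?_⟩
  have hm' : (m : ℂ) ≠ 0 := by exact_mod_cast hm
  rw [← Complex.exp_nat_mul, mul_div_cancel₀ _ hm']
  have := key z hz
  rw [Complex.exp_neg] at this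
  exact (eq_of_mul_inv_eq_one this).symm

/-- Passing to an m-th root costs at most the factor 2m, so blow-up of the spherical derivative
survives root extraction. -/
theorem sph_pow_le {f h : ℂ → ℂ} {z : ℂ} {m : ℕ} (hm : m ≠ 0) (hh : DifferentiableAt ℂ h z)
    (heq : ∀ᶠ w in 𝓝 z, h w ^ m = f w) : sph f z ≤ 2 * m * sph h z := by
  have hd : deriv f z = m * h z ^ (m - 1) * deriv h z := by
    rw [← (EventuallyEq.deriv_eq heq : deriv (fun w => h w ^ m) z = deriv f z)]
    exact (hh.hasDerivAt.fun_pow m).deriv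
  unfold sph
  rw [hd, ← heq.self_of_nhds]
  set t := ‖h z‖
  have ht : 0 ≤ t := norm_nonneg _
  simp only [norm_mul, norm_pow, Complex.norm_natCast]
  have hmono : ∀ k ≤ 2 * m, t ^ k ≤ 1 + t ^ (2 * m) := by
    intro k hk
    rcases le_total t 1 with h1 | h1
    · have := pow_le_one₀ (n := k) ht h1
      have := pow_nonneg ht (2 * m)
      linarith
    · have := pow_le_pow_right₀ h1 hk
      linarith
  have h1 := hmono (m - 1) (by omega)
  have h2 := hmono (m - 1 + 2) (by omega)
  have h3 : t ^ (m - 1) * (1 + t ^ 2) ≤ 2 * (1 + t ^ (2 * m)) := by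
    rw [mul_add, mul_one, ← pow_add]; linarith
  have h4 : (t ^ m) ^ 2 = t ^ (2 * m) := by rw [← pow_mul, mul_comm]
  rw [h4, mul_div_assoc', div_le_div_iff₀ (by positivity) (by positivity)]
  calc (m : ℝ) * t ^ (m - 1) * ‖deriv h z‖ * (1 + t ^ 2)
      = m * ‖deriv h z‖ * (t ^ (m - 1) * (1 + t ^ 2)) := by ring
    _ ≤ m * ‖deriv h z‖ * (2 * (1 + t ^ (2 * m))) := by gcongr
    _ = _ := by ring

theorem tendsto_floor_two_pow_mul_div (x : ℝ) :
    Tendsto (fun j : ℕ => (⌊2 ^ j * x⌋ : ℝ) / 2 ^ j) atTop (𝓝 x) := by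
  have h1 : Tendsto (fun j : ℕ => x - (1 / 2) ^ j) atTop (𝓝 (x - 0)) :=
    (tendsto_pow_atTop_nhds_zero_of_lt_one (by norm_num) (by norm_num)).const_sub x
  rw [sub_zero] at h1
  refine tendsto_of_tendsto_of_tendsto_of_le_of_le h1 tendsto_const_nhds (fun j => ?_) fun j => ?_
  · have h2 : (0 : ℝ) < 2 ^ j := by positivity
    have h3 := (Int.sub_one_lt_floor ((2 : ℝ) ^ j * x)).le
    simp only
    rw [le_div_iff₀ h2, sub_mul, one_div, inv_pow, inv_mul_cancel₀ h2.ne']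
    linarith
  · have h2 : (0 : ℝ) < 2 ^ j := by positivity
    have h3 := Int.floor_le ((2 : ℝ) ^ j * x)
    simp only
    rw [div_le_iff₀ h2]
    linarith

/-- Roots of unity of order a power of two are dense in the unit circle. -/
theorem exists_dyadic_root_of_unity {w : ℂ} (hw : ‖w‖ = 1) {V : Set ℂ} (hV : V ∈ 𝓝 w) :
    ∃ ω ∈ V, ∃ j : ℕ, ω ^ 2 ^ j = 1 := by
  obtain ⟨θ, hθ⟩ := (Complex.norm_eq_one_iff w).1 hw
  set x := θ / (2 * Real.pi)
  have hc : Continuous fun y : ℝ => Complex.exp (2 * Real.pi * Complex.I * y) := by fun_prop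
  have hlim := (hc.tendsto x).comp (tendsto_floor_two_pow_mul_div x)
  have hx : Complex.exp (2 * Real.pi * Complex.I * x) = w := by
    rw [← hθ]
    congr 1
    have : (Real.pi : ℂ) ≠ 0 := by exact_mod_cast Real.pi_ne_zero
    simp only [x]
    push_cast
    field_simp
  simp only [hx] at hlim
  obtain ⟨j, hj⟩ := (hlim.eventually hV).exists
  refine ⟨_, hj, j, ?_⟩
  simp only [Function.comp]
  rw [← Complex.exp_nat_mul, Complex.exp_eq_one_iff]
  refine ⟨⌊2 ^ j * x⌋, ?_⟩
  push_cast
  field_simp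

/-- The range is open and misses a dense subset of the unit circle, hence the whole circle. By
connectedness it lies inside or outside, and Liouville applies to G or to 1 / G. -/
theorem false_of_omits_dyadic {G : ℂ → ℂ} (hG : Differentiable ℂ G) (h0 : sph G 0 = 1)
    (hom : ∀ ω : ℂ, ∀ j : ℕ, ω ^ 2 ^ j = 1 → ∀ z, G z ≠ ω) : False := by
  have hnc : ∀ c, G ≠ fun _ => c := by
    rintro c rfl
    simp [sph] at h0
  have hopen : IsOpenMap G := by
    rcases (hG.differentiableOn.analyticOnNhd isOpen_univ).is_constant_or_isOpenMap with ⟨c, h⟩ | h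
    · exact absurd (funext h) (hnc c)
    · exact h
  have hne : ∀ z, ‖G z‖ ≠ 1 := by
    intro z hz
    obtain ⟨ω, ⟨y, hy⟩, j, hj⟩ := exists_dyadic_root_of_unity hz
      (hopen.isOpen_range.mem_nhds (mem_range_self z))
    exact hom ω j hj y hy
  have hcont : Continuous fun z => ‖G z‖ := hG.continuous.norm
  have hbdd : ∀ H : ℂ → ℂ, Differentiable ℂ H → (∀ z, ‖H z‖ ≤ 1) → ∃ c, H = fun _ => c := by
    intro H hH hb
    obtain ⟨c, hc⟩ := hH.exists_const_forall_eq_of_bounded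
      (isBounded_iff_forall_norm_le.2 ⟨1, by rintro _ ⟨z, rfl⟩; exact hb z⟩)
    exact ⟨c, funext hc⟩
  by_cases hlt : ∀ z, ‖G z‖ ≤ 1
  · obtain ⟨c, hc⟩ := hbdd G hG hlt
    exact hnc c hc
  · push Not at hlt
    obtain ⟨z₁, hz₁⟩ := hlt
    have hgt : ∀ z, 1 < ‖G z‖ := by
      intro z
      by_contra hz
      obtain ⟨y, hy⟩ := mem_range_of_exists_le_of_exists_ge hcont ⟨z, not_lt.1 hz⟩ ⟨z₁, hz₁.le⟩
      exact hne y hy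
    have hne0 : ∀ z, G z ≠ 0 := fun z hz => by
      have := hgt z; rw [hz, norm_zero] at this; linarith
    obtain ⟨c, hc⟩ := hbdd (fun z => (G z)⁻¹) (hG.fun_inv hne0) fun z => by
      rw [norm_inv]; exact inv_le_one_of_one_le₀ (hgt z).le
    refine hnc c⁻¹ (funext fun z => ?_)
    rw [← congrFun hc z, inv_inv]

/-- Montel's fundamental normality test, in terms of the spherical derivative. -/
theorem exists_sph_bound_of_omits_zero_one : ∃ C : ℝ, ∀ f : ℂ → ℂ,
    DifferentiableOn ℂ f (ball 0 1) → (∀ z ∈ ball 0 1, f z ≠ 0 ∧ f z ≠ 1) →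
    ∀ z : ℂ, ‖z‖ ≤ 1 / 2 → sph f z ≤ C := by
  by_contra! hcon
  choose f hf hom a ha hsph using fun n : ℕ => hcon n
  have htop : Tendsto (fun n => sph (f n) (a n)) atTop atTop :=
    tendsto_atTop_mono (fun n => (hsph n).le) tendsto_natCast_atTop_atTop
  -- The 2^k-th roots of the f n omit all 2^k-th roots of unity, and their Zalcman limit inherits
  -- this.
  have hroot : ∀ k : ℕ, ∃ G : ℂ → ℂ, Differentiable ℂ G ∧ (∀ z, sph G z ≤ 1) ∧ sph G 0 = 1 ∧
      ∀ ω : ℂ, ω ^ 2 ^ k = 1 → ∀ z, G z ≠ ω := by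
    intro k
    have hm : 2 ^ k ≠ 0 := by positivity
    choose h hh heq using fun n => exists_differentiableOn_pow_eq one_pos (hf n)
      (fun z hz => (hom n z hz).1) hm
    have hball : ∀ n, ball (0 : ℂ) 1 ∈ 𝓝 (a n) := fun n => isOpen_ball.mem_nhds (by
      rw [mem_ball_zero_iff]; have := ha n; linarith)
    have htop' : Tendsto (fun n => sph (h n) (a n)) atTop atTop := by
      have hc : (0 : ℝ) < (2 * ((2 ^ k : ℕ) : ℝ))⁻¹ := by positivity
      refine tendsto_atTop_mono (fun n => ?_) (htop.const_mul_atTop hc)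
      rw [inv_mul_le_iff₀ (by positivity)]
      exact sph_pow_le hm ((hh n).differentiableAt (hball n))
        (eventually_of_mem (hball n) (heq n))
    obtain ⟨φ, hφ, z, ρ, G, hz, hρ, hρ0, hG, hG1, hG2, hG3⟩ := zalcman hh ha htop'
    refine ⟨G, hG, hG1, hG2, fun ω hω => forall_ne_of_limit hG hG2 (fun R hR => ?_) hG3⟩
    filter_upwards [hρ, hρ0.eventually_lt_const (show 0 < 1 / (4 * R) by positivity)] with n h1 h2
    have hmaps : MapsTo (fun ζ => z n + ρ n * ζ) (ball 0 R) (ball 0 1) := by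
      intro ζ hζ
      rw [mem_ball_zero_iff] at hζ ⊢
      calc ‖z n + ρ n * ζ‖ ≤ ‖z n‖ + ρ n * ‖ζ‖ := by
            refine (norm_add_le _ _).trans ?_
            rw [norm_mul, Complex.norm_real, Real.norm_of_nonneg h1.le]
        _ ≤ 3 / 4 + ρ n * R := by gcongr; exact hz n
        _ < 3 / 4 + 1 / (4 * R) * R := by gcongr
        _ = 1 := by field_simp; norm_num
    refine ⟨(hh _).comp (Differentiable.differentiableOn (by fun_prop)) hmaps, fun ζ hζ h3 => ?_⟩
    have h4 := heq (φ n) _ (hmaps hζ)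
    simp only at h4
    rw [h3, hω] at h4
    exact (hom _ _ (hmaps hζ)).2 h4.symm
  choose G hG hG1 hG2 hG3 using hroot
  obtain ⟨φ, hφ, H, hH, -, hH0, hlim⟩ := exists_entire_limit (F := G)
    (fun R hR ε hε => Eventually.of_forall fun k => ⟨(hG k).differentiableOn, fun z _ =>
      (hG1 k z).trans (by linarith)⟩) (Eventually.of_forall hG2)
  refine false_of_omits_dyadic hH hH0 fun ω j hω => forall_ne_of_limit hH hH0 (fun R hR => ?_) hlim
  -- Roots of unity of order 2^j are also of order 2^n for n ≥ j, so the limit over k omits all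
  -- dyadic ones.
  filter_upwards [eventually_ge_atTop j] with n hn
  refine ⟨(hG _).differentiableOn, fun z _ => hG3 _ ω ?_ z⟩
  obtain ⟨i, hi⟩ := Nat.exists_eq_add_of_le (hn.trans (hφ.le_apply (x := n)))
  rw [hi, pow_add, pow_mul, hω, one_pow]

theorem exists_sph_bound : ∃ C : ℝ, ∀ (f : ℂ → ℂ) (x : ℂ) (r : ℝ), 0 < r →
    DifferentiableOn ℂ f (ball x r) → (∀ z ∈ ball x r, f z ≠ 0 ∧ f z ≠ 1) →
    ∀ z ∈ ball x (r / 2), sph f z ≤ C / r := by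
  obtain ⟨C, hC⟩ := exists_sph_bound_of_omits_zero_one
  refine ⟨C, fun f x r hr hf hom z hz => ?_⟩
  have hmaps : MapsTo (fun ζ => x + r * ζ) (ball (0 : ℂ) 1) (ball x r) := by
    intro ζ hζ
    rw [mem_ball_zero_iff] at hζ
    simp only [mem_ball, dist_eq_norm, add_sub_cancel_left, norm_mul, Complex.norm_real,
      Real.norm_of_nonneg hr.le]
    nlinarith
  have hr' : (r : ℂ) ≠ 0 := by exact_mod_cast hr.ne'
  have h := hC (fun ζ => f (x + r * ζ)) (hf.comp (Differentiable.differentiableOn (by fun_prop))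
    hmaps) (fun ζ hζ => hom _ (hmaps hζ)) ((z - x) / r) (by
    rw [mem_ball, dist_eq_norm] at hz
    rw [norm_div, Complex.norm_real, Real.norm_of_nonneg hr.le, div_le_iff₀ hr]
    linarith)
  rw [sph_comp_affine, Complex.norm_real, Real.norm_of_nonneg hr.le, mul_div_cancel₀ _ hr',
    add_sub_cancel] at h
  rw [le_div_iff₀ hr]
  linarith

/-- Picard's little theorem. -/
theorem picard {f : ℂ → ℂ} (hf : Differentiable ℂ f) (h0 : ∀ z, f z ≠ 0) (h1 : ∀ z, f z ≠ 1) :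
    ∃ c, f = fun _ => c := by
  obtain ⟨C, hC⟩ := exists_sph_bound
  -- The bound C / r holds on discs of every radius r.
  have hsph : ∀ z, sph f z = 0 := by
    intro z
    refine le_antisymm ?_ (sph_nonneg f z)
    refine ge_of_tendsto (tendsto_const_nhds.div_atTop tendsto_id : Tendsto (fun r : ℝ => C / r)
      atTop (𝓝 0)) ?_
    filter_upwards [eventually_gt_atTop 0] with r hr
    exact hC f z r hr hf.differentiableOn (fun z _ => ⟨h0 z, h1 z⟩) z (mem_ball_self (by positivity))
  refine ⟨f 0, funext fun z => is_const_of_deriv_eq_zero hf (fun z => ?_) z 0⟩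
  have := norm_deriv_eq_sph_mul f z
  rwa [hsph, zero_mul, norm_eq_zero] at this

/-! ### Growth of transcendental entire functions -/

/-- Cauchy's estimates along an unbounded set of radii kill every Taylor coefficient of order above
n. -/
theorem exists_polynomial_of_frequently_norm_le {f : ℂ → ℂ} (hf : Differentiable ℂ f) {C : ℝ}
    {n : ℕ} (h : ∃ᶠ R in atTop, ∀ z ∈ sphere (0 : ℂ) R, ‖f z‖ ≤ C * R ^ n) :
    ∃ p : Polynomial ℂ, f = fun z => p.eval z := by
  have hzero : ∀ k, n < k → iteratedDeriv k f 0 = 0 := by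
    intro k hk
    by_contra hne
    have hlim : Tendsto (fun R : ℝ => k.factorial * C * (R ^ (k - n))⁻¹) atTop
        (𝓝 (k.factorial * C * 0)) :=
      (tendsto_inv_atTop_zero.comp (tendsto_pow_atTop (by omega))).const_mul _
    rw [mul_zero] at hlim
    obtain ⟨R, ⟨h1, h2⟩, h3⟩ := ((h.and_eventually (eventually_gt_atTop 0)).and_eventually
      (hlim.eventually_lt_const (norm_pos_iff.2 hne))).exists
    have h4 := Complex.norm_iteratedDeriv_le_of_forall_mem_sphere_norm_le k h2
      hf.diffContOnCl h1
    have h5 : k.factorial * (C * R ^ n) / R ^ k = k.factorial * C * (R ^ (k - n))⁻¹ := by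
      have : R ^ k = R ^ (k - n) * R ^ n := by rw [← pow_add]; congr 1; omega
      rw [this]
      field_simp
    linarith
  refine ⟨∑ k ∈ Finset.range (n + 1),
    Polynomial.C ((k.factorial : ℂ)⁻¹ * iteratedDeriv k f 0) * Polynomial.X ^ k, funext fun z => ?_⟩
  rw [← Complex.taylorSeries_eq_of_entire' 0 z hf, tsum_eq_sum (s := Finset.range (n + 1))]
  · simp [Polynomial.eval_finsetSum]
  · intro k hk
    rw [hzero k (by simpa using hk)]
    simp

/-- An entire function without essential singularity at infinity is a polynomial. -/
theorem exists_polynomial_of_le_norm_sub {f : ℂ → ℂ} (hf : Differentiable ℂ f) {c : ℂ} {δ R : ℝ}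
    (hδ : 0 < δ) (h : ∀ z, R ≤ ‖z‖ → δ ≤ ‖f z - c‖) :
    ∃ p : Polynomial ℂ, f = fun z => p.eval z := by
  set R' := max R 1
  have hR' : 0 < R' := by positivity
  -- g is bounded near 0, so its singularity is removable; the order n of the extension at 0 bounds
  -- the growth of f.
  set g : ℂ → ℂ := fun z => (f z⁻¹ - c)⁻¹ with hg
  have hbig : ∀ z ∈ ball (0 : ℂ) R'⁻¹ \ {0}, δ ≤ ‖f z⁻¹ - c‖ := by
    rintro z ⟨hz, hz0⟩
    refine h _ ((le_max_left R 1).trans ?_)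
    rw [mem_ball_zero_iff] at hz
    rw [norm_inv]
    exact (le_inv_comm₀ hR' (norm_pos_iff.2 hz0)).2 hz.le
  have hne : ∀ z ∈ ball (0 : ℂ) R'⁻¹ \ {0}, f z⁻¹ - c ≠ 0 := fun z hz h0 => by
    have := hbig z hz
    rw [h0, norm_zero] at this
    linarith
  have hball : ball (0 : ℂ) R'⁻¹ ∈ 𝓝 0 := ball_mem_nhds _ (by positivity)
  have hd := Complex.differentiableOn_update_limUnder_of_bddAbove (f := g) hball (by
    intro z hz
    refine DifferentiableAt.differentiableWithinAt ?_
    have h1 : DifferentiableAt ℂ (fun z => f z⁻¹) z :=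
      (hf.differentiableAt).comp z (differentiableAt_inv hz.2)
    exact (h1.sub_const c).fun_inv (hne z hz)) (by
    refine ⟨δ⁻¹, ?_⟩
    rintro _ ⟨z, hz, rfl⟩
    simp only [Function.comp, hg, norm_inv]
    exact inv_anti₀ hδ (hbig z hz))
  set G := Function.update g 0 (limUnder (𝓝[≠] 0) g)
  have hGeq : ∀ z, z ≠ 0 → G z = g z := fun z hz => Function.update_of_ne hz _ _
  have hGa : AnalyticAt ℂ G 0 := hd.analyticAt hball
  obtain ⟨n, u, hu, hu0, hGu⟩ := hGa.exists_eventuallyEq_pow_smul_nonzero_iff.2 (by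
    intro h0
    have h1 : ∀ᶠ z in 𝓝[≠] (0 : ℂ), False := by
      filter_upwards [h0.filter_mono nhdsWithin_le_nhds, self_mem_nhdsWithin,
        mem_nhdsWithin_of_mem_nhds hball] with z h1 h2 h3
      rw [hGeq z h2] at h1
      exact inv_ne_zero (hne z ⟨h3, h2⟩) h1
    exact (eventually_false_iff_eq_bot.1 h1 |> (NormedField.nhdsNE_neBot (0 : ℂ)).ne))
  have hev : ∀ᶠ z in 𝓝 (0 : ℂ), ‖u 0‖ / 2 < ‖u z‖ := by
    have := norm_pos_iff.2 hu0
    exact hu.continuousAt.norm.eventually_const_lt (by linarith)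
  obtain ⟨ε, hε, hball2⟩ := Metric.eventually_nhds_iff_ball.1 (hev.and hGu)
  refine exists_polynomial_of_frequently_norm_le hf (C := (‖u 0‖ / 2)⁻¹ + ‖c‖) (n := n)
    (Eventually.frequently ?_)
  filter_upwards [eventually_gt_atTop ε⁻¹, eventually_ge_atTop 1] with S hS hS1 w hw
  have hwn : ‖w‖ = S := by simpa using hw
  have hw0 : w ≠ 0 := by rw [← norm_pos_iff, hwn]; linarith
  obtain ⟨h1, h2⟩ := hball2 w⁻¹ (by
    rw [mem_ball_zero_iff, norm_inv, hwn]
    exact inv_lt_of_inv_lt₀ hε hS)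
  rw [hGeq _ (inv_ne_zero hw0), hg] at h2
  simp only [inv_inv, sub_zero, smul_eq_mul] at h2
  have h3 : ‖f w - c‖ = S ^ n * ‖u w⁻¹‖⁻¹ := by
    rw [← inv_inv (f w - c), h2, norm_inv, norm_mul, norm_pow, norm_inv, hwn, mul_inv, inv_pow,
      inv_inv]
  have hu0' := norm_pos_iff.2 hu0
  have h4 : ‖u w⁻¹‖⁻¹ ≤ (‖u 0‖ / 2)⁻¹ := inv_anti₀ (by linarith) h1.le
  have h5 : 1 ≤ S ^ n := one_le_pow₀ hS1
  calc ‖f w‖ = ‖(f w - c) + c‖ := by rw [sub_add_cancel]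
    _ ≤ ‖f w - c‖ + ‖c‖ := norm_add_le _ _
    _ ≤ S ^ n * (‖u 0‖ / 2)⁻¹ + ‖c‖ * S ^ n := by
        rw [h3]
        gcongr
        exact le_mul_of_one_le_right (norm_nonneg c) h5
    _ = _ := by ring

/-- For a transcendental entire function `f`, the spherical derivative of `f z / z` is not
`O(1 / |z|)` at infinity. -/
theorem exists_large_norm_mul_sph {f : ℂ → ℂ} (hf : IsTranscendentalEntire f) (R A : ℝ) :
    ∃ w : ℂ, R ≤ ‖w‖ ∧ A ≤ ‖w‖ * sph (fun z => f z / z) w := by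
  by_contra! hcon
  have hpts : ∀ n : ℕ, ∃ z : ℂ, (n : ℝ) + 1 ≤ ‖z‖ ∧ ‖f z / z‖ < 1 := by
    by_contra! h
    obtain ⟨n, hn⟩ := h
    obtain ⟨p, hp⟩ := exists_polynomial_of_le_norm_sub hf.1 (c := 0) one_pos
      (R := n + 1) (fun z hz => by
        have h1 := hn z hz
        have h2 : (1 : ℝ) ≤ ‖z‖ := by have : (0 : ℝ) ≤ n := n.cast_nonneg; linarith
        rw [norm_div, le_div_iff₀ (by linarith)] at h1
        rw [sub_zero]
        linarith)
    exact hf.2 p hp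
  choose z hz hfz using hpts
  have hztop : Tendsto (fun n => ‖z n‖) atTop atTop :=
    tendsto_atTop_mono (fun n => (by have := hz n; linarith : (n : ℝ) ≤ ‖z n‖))
      tendsto_natCast_atTop_atTop
  have hz0 : ∀ n, z n ≠ 0 := fun n => by
    rw [← norm_pos_iff]; have := hz n; have : (0 : ℝ) ≤ n := n.cast_nonneg; linarith
  -- The denied growth bounds the spherical derivative of F n by A / ‖ζ‖, so Marty applies on the
  -- punctured plane. A finite limit makes f grow linearly on the circles ‖w‖ = ‖z n‖; the limit ∞
  -- contradicts ‖F n 1‖ < 1.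
  set F : ℕ → ℂ → ℂ := fun n ζ => f (0 + z n * ζ) / (0 + z n * ζ) with hF
  have hconn : IsPreconnected ({0}ᶜ : Set ℂ) :=
    (isConnected_compl_singleton_of_one_lt_rank (by simp) 0).isPreconnected
  obtain ⟨φ, hφ, h⟩ := exists_subseq_of_sph_bounded hconn (F := F) (by
    intro x hx
    have hx0 : 0 < ‖x‖ := norm_pos_iff.2 hx
    refine ⟨‖x‖ / 2, by positivity, A / (‖x‖ / 2), ?_⟩
    filter_upwards [(hztop.atTop_mul_const (half_pos hx0)).eventually_ge_atTop R] with n hn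
    have hlow : ∀ ζ ∈ ball x (‖x‖ / 2), ‖x‖ / 2 ≤ ‖ζ‖ := by
      intro ζ hζ
      rw [mem_ball, dist_eq_norm, norm_sub_rev] at hζ
      have := norm_sub_norm_le x ζ
      linarith
    have hne : ∀ ζ ∈ ball x (‖x‖ / 2), 0 + z n * ζ ≠ 0 := by
      intro ζ hζ
      rw [zero_add]
      refine mul_ne_zero (hz0 n) ?_
      rw [← norm_pos_iff]
      have := hlow ζ hζ
      linarith
    refine ⟨?_, fun ζ hζ => ?_⟩
    · have h1 : Differentiable ℂ fun ζ : ℂ => 0 + z n * ζ := by fun_prop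
      exact (hf.1.comp h1).differentiableOn.fun_div h1.differentiableOn hne
    · have h1 := hlow ζ hζ
      rw [show F n = fun ζ => (fun z => f z / z) (0 + z n * ζ) from rfl,
        sph_comp_affine (fun z => f z / z)]
      have h3 : ‖0 + z n * ζ‖ = ‖z n‖ * ‖ζ‖ := by rw [zero_add, norm_mul]
      have h2 := hcon (0 + z n * ζ) (by
        rw [h3]
        refine hn.trans ?_
        gcongr)
      rw [h3] at h2
      have h4 := sph_nonneg (fun z => f z / z) (0 + z n * ζ)
      rw [le_div_iff₀ (by positivity)]
      calc ‖z n‖ * sph (fun z => f z / z) (0 + z n * ζ) * (‖x‖ / 2)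
          ≤ ‖z n‖ * sph (fun z => f z / z) (0 + z n * ζ) * ‖ζ‖ := by gcongr
        _ ≤ A := by linarith)
  have hF1 : ∀ n, ‖F n 1‖ < 1 := fun n => by simpa [hF] using hfz n
  rcases h with ⟨G, hG⟩ | h
  · have hsub : sphere (0 : ℂ) 1 ⊆ {0}ᶜ := fun y hy h0 => by
      rw [mem_singleton_iff] at h0; simp [h0] at hy
    have hun : TendstoUniformlyOn (fun n => F (φ n)) G atTop (sphere 0 1) :=
      (tendstoLocallyUniformlyOn_iff_tendstoUniformlyOn_of_compact (isCompact_sphere _ _)).1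
        (hG.mono hsub)
    have hGc : ContinuousOn G (sphere 0 1) := hun.continuousOn (Frequently.of_forall fun n => by
      refine ContinuousOn.div₀ ?_ (by fun_prop) fun y hy => ?_
      · exact (hf.1.continuous.comp (by fun_prop : Continuous fun ζ : ℂ => 0 + z (φ n) * ζ)).continuousOn
      · rw [zero_add]; exact mul_ne_zero (hz0 _) (hsub hy))
    obtain ⟨M, hM⟩ := (isCompact_sphere (0 : ℂ) 1).exists_bound_of_continuousOn hGc
    obtain ⟨p, hp⟩ := exists_polynomial_of_frequently_norm_le hf.1 (C := M + 1) (n := 1) (by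
      refine (hztop.comp hφ.tendsto_atTop).frequently (Eventually.frequently ?_)
      filter_upwards [Metric.tendstoUniformlyOn_iff.1 hun 1 one_pos] with n hn w hw
      have hwn : ‖w‖ = ‖z (φ n)‖ := by simpa using hw
      have hzn := hz0 (φ n)
      have hmem : w / z (φ n) ∈ sphere (0 : ℂ) 1 := by
        simp [hwn, hzn]
      have h1 := hn _ hmem
      have h2 := hM _ hmem
      have h3 : F (φ n) (w / z (φ n)) = f w / w := by
        simp only [hF, zero_add]
        rw [mul_div_cancel₀ _ hzn]
      rw [h3, dist_comm, dist_eq_norm] at h1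
      have h4 := norm_sub_norm_le (f w / w) (G (w / z (φ n)))
      have h5 : ‖f w / w‖ ≤ M + 1 := by linarith
      have h6 : 0 < ‖w‖ := by rw [hwn]; exact norm_pos_iff.2 hzn
      rw [norm_div, div_le_iff₀ h6, hwn] at h5
      simpa using h5)
    exact hf.2 p hp
  · obtain ⟨n, hn⟩ := (h {1} (by simp) isCompact_singleton 1).exists
    have := hn 1 rfl
    have := hF1 (φ n)
    linarith

/-! ### Fixed points of the second iterate -/

theorem countable_zeros {G : ℂ → ℂ} (hG : Differentiable ℂ G) (hne : ∃ z, G z ≠ 0) :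
    {z | G z = 0}.Countable := by
  obtain ⟨w, hw⟩ := hne
  have h : {z | G z = 0}ᶜ ∈ codiscrete ℂ := by
    rw [mem_codiscrete]
    intro x
    rw [compl_compl, disjoint_principal_right]
    rcases (hG.analyticAt x).eventually_eq_zero_or_eventually_ne_zero with h | h
    · exact absurd (congrFun (eq_const_of_eventually_eq hG h) w) hw
    · exact h
  exact (HereditarilyLindelofSpace.isLindelof _).countable_of_isDiscrete
    (compl_mem_codiscrete_iff.1 h).2

/-- Rosenbloom: the second iterate of a transcendental entire function has arbitrarily large fixed
points. -/
theorem exists_large_fixed_point {f : ℂ → ℂ} (hf : IsTranscendentalEntire f) (R₀ : ℝ) :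
    ∃ z : ℂ, R₀ < ‖z‖ ∧ f (f z) = z := by
  by_contra! hfix
  have hfd := hf.1
  choose w hwn hws using fun n : ℕ => exists_large_norm_mul_sph hf (n + 1) n
  have hw0 : ∀ n, 0 < ‖w n‖ := fun n => by
    have := hwn n; have : (0 : ℝ) ≤ n := n.cast_nonneg; linarith
  have hwtop : Tendsto (fun n => ‖w n‖) atTop atTop :=
    tendsto_atTop_mono (fun n => (by have := hwn n; linarith : (n : ℝ) ≤ ‖w n‖))
      tendsto_natCast_atTop_atTop
  set q : ℂ → ℂ := fun z => f z / z with hq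
  have hqd : ∀ z ≠ 0, DifferentiableAt ℂ q z := fun z hz =>
    (hfd z).fun_div differentiableAt_id hz
  have hlow : ∀ (n : ℕ) (u : ℂ), ‖u‖ < 1 → ‖w n‖ / 2 ≤ ‖w n + w n / 2 * u‖ := by
    intro n u hu
    have h1 := norm_sub_le_norm_add (w n) (w n / 2 * u)
    have h2 : ‖w n / 2 * u‖ = ‖w n‖ / 2 * ‖u‖ := by simp
    have := hw0 n
    nlinarith
  have hupp : ∀ (n : ℕ) (u : ℂ), ‖u‖ < 1 → ‖w n + w n / 2 * u‖ ≤ 2 * ‖w n‖ := by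
    intro n u hu
    have h1 := norm_add_le (w n) (w n / 2 * u)
    have h2 : ‖w n / 2 * u‖ = ‖w n‖ / 2 * ‖u‖ := by simp
    have := hw0 n
    nlinarith
  -- Zalcman is applied to f(z)/z on the discs about w n of radius ‖w n‖ / 2; the rescaled spherical
  -- derivative at the centre is at least n / 2.
  obtain ⟨φ, hφ, z, ρ, G, hz, hρ, hρ0, hG, -, hG0, hlim⟩ := zalcman
    (f := fun n u => q (w n + w n / 2 * u)) (a := fun _ => 0) (fun n u hu => by
      rw [mem_ball_zero_iff] at hu
      have h1 : w n + w n / 2 * u ≠ 0 := by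
        rw [← norm_pos_iff]; have := hlow n u hu; have := hw0 n; linarith
      exact ((hqd _ h1).comp u (by fun_prop :
        DifferentiableAt ℂ (fun u => w n + w n / 2 * u) u)).differentiableWithinAt)
    (fun n => by simp) (by
      refine tendsto_atTop_mono (fun n => ?_)
        (tendsto_natCast_atTop_atTop.const_mul_atTop (show (0 : ℝ) < 1 / 2 by norm_num))
      rw [sph_comp_affine, mul_zero, add_zero, norm_div]
      have := hws n
      norm_num
      linarith)
  set W := fun n => ‖w (φ n)‖ with hW
  set p : ℕ → ℂ → ℂ := fun n ζ => w (φ n) + w (φ n) / 2 * (z n + ρ n * ζ) with hp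
  have hpd : ∀ n, Differentiable ℂ (p n) := fun n => by simp only [hp]; fun_prop
  have hW0 : ∀ n, 0 < W n := fun n => hw0 _
  have hWtop : Tendsto W atTop atTop := hwtop.comp hφ.tendsto_atTop
  have hpW : ∀ R > 0, ∀ᶠ n in atTop, ∀ ζ ∈ ball (0 : ℂ) R,
      W n / 2 ≤ ‖p n ζ‖ ∧ ‖p n ζ‖ ≤ 2 * W n := by
    intro R hR
    filter_upwards [hρ, hρ0.eventually_lt_const (show 0 < 1 / (4 * R) by positivity)]
      with n h1 h2 ζ hζ
    have h3 : ‖z n + ρ n * ζ‖ < 1 := by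
      rw [mem_ball_zero_iff] at hζ
      calc ‖z n + ρ n * ζ‖ ≤ ‖z n‖ + ρ n * ‖ζ‖ := by
            refine (norm_add_le _ _).trans ?_
            rw [norm_mul, Complex.norm_real, Real.norm_of_nonneg h1.le]
        _ ≤ 3 / 4 + ρ n * R := by gcongr; exact hz n
        _ < 3 / 4 + 1 / (4 * R) * R := by gcongr
        _ = 1 := by field_simp; norm_num
    exact ⟨hlow _ _ h3, hupp _ _ h3⟩
  have hplarge : ∀ R > 0, ∀ᶠ n in atTop, ∀ ζ ∈ ball (0 : ℂ) R, R₀ < ‖p n ζ‖ ∧ p n ζ ≠ 0 := by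
    intro R hR
    filter_upwards [hpW R hR, hWtop.eventually_gt_atTop (2 * R₀)] with n h1 h2 ζ hζ
    have := h1 ζ hζ
    have := hW0 n
    exact ⟨by linarith, norm_pos_iff.1 (by linarith)⟩
  replace hlim : TendstoLocallyUniformlyOn (fun n ζ => q (p n ζ)) G atTop univ := hlim
  have hG1 : ∀ ζ, G ζ ≠ 1 := forall_ne_of_limit hG hG0 (fun R hR => by
    filter_upwards [hplarge R hR] with n hn
    refine ⟨fun ζ hζ => ((hqd _ (hn ζ hζ).2).comp ζ (hpd n ζ)).differentiableWithinAt,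
      fun ζ hζ h1 => ?_⟩
    obtain ⟨h2, h3⟩ := hn ζ hζ
    have h4 : f (p n ζ) = p n ζ := (div_eq_one_iff_eq h3).1 h1
    exact hfix _ h2 (by rw [h4, h4])) hlim
  have hGnc : ∀ c, G ≠ fun _ => c := by
    rintro c rfl
    simp [sph] at hG0
  -- G omits 1 because fixed points of f are fixed by f ∘ f; being nonconstant, it must then take
  -- the value 0.
  obtain ⟨ζ₀, hζ₀⟩ : ∃ ζ, G ζ = 0 := by
    by_contra! h
    obtain ⟨c, hc⟩ := picard hG h hG1
    exact hGnc c hc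
  have hGne : ∃ ζ, G ζ ≠ 0 := by
    by_contra! h
    exact hGnc 0 (funext h)
  have hconn : IsPreconnected {ζ | G ζ = 0}ᶜ :=
    ((countable_zeros hG hGne).isConnected_compl_of_one_lt_rank (by simp)).isPreconnected
  have hun : ∀ K : Set ℂ, IsCompact K → TendstoUniformlyOn (fun n ζ => q (p n ζ)) G atTop K :=
    fun K hK => (tendstoLocallyUniformlyOn_iff_tendstoUniformlyOn_of_compact hK).1
      (hlim.mono (subset_univ _))
  -- With u = p n ζ, this is (f(f(u)) - u) / (f(u) - u). Its poles, zeros and ones come from f(u) =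
  -- u, f(f(u)) = u and f(f(u)) = f(u). All are excluded eventually, locally away from the zeros of
  -- G, where f(u) is also large.
  set k : ℕ → ℂ → ℂ := fun n ζ => (f (f (p n ζ)) / p n ζ - 1) / (q (p n ζ) - 1) with hk
  obtain ⟨C, hC⟩ := exists_sph_bound
  obtain ⟨ψ, hψ, hdich⟩ := exists_subseq_of_sph_bounded hconn (F := k) (by
    intro x hx
    have hx0 : 0 < ‖G x‖ := norm_pos_iff.2 hx
    obtain ⟨s, hs, hball⟩ := Metric.eventually_nhds_iff_ball.1
      (hG.continuous.continuousAt.norm.eventually_const_lt (show ‖G x‖ / 2 < ‖G x‖ by linarith))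
    refine ⟨s / 2, by positivity, C / s, ?_⟩
    have hsub : ball x s ⊆ ball 0 (‖x‖ + s) := ball_subset_ball' (by simp [add_comm])
    have hun' : TendstoUniformlyOn (fun n ζ => q (p n ζ)) G atTop (ball x s) :=
      (hun _ (isCompact_closedBall x s)).mono ball_subset_closedBall
    filter_upwards [hpW (‖x‖ + s) (by positivity), hplarge (‖x‖ + s) (by positivity),
      Metric.tendstoUniformlyOn_iff.1 hun' (‖G x‖ / 4) (by positivity),
      (hWtop.const_mul_atTop (show 0 < ‖G x‖ / 8 by positivity)).eventually_gt_atTop R₀]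
      with n h1 h2 h3 h4
    have hq1 : ∀ ζ ∈ ball x s, q (p n ζ) - 1 ≠ 0 := by
      intro ζ hζ h5
      obtain ⟨h6, h7⟩ := h2 ζ (hsub hζ)
      have h4 : f (p n ζ) = p n ζ := (div_eq_one_iff_eq h7).1 (sub_eq_zero.1 h5)
      exact hfix _ h6 (by rw [h4, h4])
    have hd : DifferentiableOn ℂ (k n) (ball x s) := by
      intro ζ hζ
      have h7 := (h2 ζ (hsub hζ)).2
      have hffp : DifferentiableAt ℂ (fun ζ => f (f (p n ζ))) ζ :=
        (hfd.comp (hfd.comp (hpd n))) ζ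
      have hqp : DifferentiableAt ℂ (fun ζ => q (p n ζ)) ζ := (hqd _ h7).comp ζ (hpd n ζ)
      exact (((hffp.fun_div (hpd n ζ) h7).sub_const 1).fun_div (hqp.sub_const 1)
        (hq1 ζ hζ)).differentiableWithinAt
    refine ⟨hd.mono (ball_subset_ball (by linarith)), hC (k n) x s hs hd fun ζ hζ => ?_⟩
    obtain ⟨h6, h7⟩ := h2 ζ (hsub hζ)
    constructor
    · intro h8
      rcases div_eq_zero_iff.1 h8 with h9 | h9
      · exact hfix _ h6 ((div_eq_one_iff_eq h7).1 (sub_eq_zero.1 h9))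
      · exact hq1 ζ hζ h9
    · intro h8
      have h9 : f (f (p n ζ)) / p n ζ = f (p n ζ) / p n ζ :=
        sub_left_injective ((div_eq_one_iff_eq (hq1 ζ hζ)).1 h8)
      have h10 : f (f (p n ζ)) = f (p n ζ) := (div_left_inj' h7).1 h9
      refine hfix (f (p n ζ)) ?_ (by rw [h10, h10])
      have h11 := h3 ζ hζ
      have h12 := hball ζ hζ
      rw [dist_eq_norm] at h11
      have h13 := norm_sub_norm_le (G ζ) (q (p n ζ))
      have h14 : ‖G x‖ / 4 ≤ ‖q (p n ζ)‖ := by linarith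
      have h15 := (h1 ζ (hsub hζ)).1
      have h16 : f (p n ζ) = q (p n ζ) * p n ζ := (div_mul_cancel₀ _ h7).symm
      rw [h16, norm_mul]
      have := hW0 n
      calc R₀ < ‖G x‖ / 8 * W n := h4
        _ = ‖G x‖ / 4 * (W n / 2) := by ring
        _ ≤ _ := by gcongr)
  -- a circle about the zero `ζ₀` of `G`
  obtain ⟨s, hs, hcirc⟩ : ∃ s > 0, ∀ ζ ∈ sphere ζ₀ s, G ζ ≠ 0 := by
    rcases (hG.analyticAt ζ₀).eventually_eq_zero_or_eventually_ne_zero with h | h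
    · exact absurd (eq_const_of_eventually_eq hG h) (hGnc 0)
    rw [eventually_nhdsWithin_iff, Metric.eventually_nhds_iff] at h
    obtain ⟨ε, hε, h⟩ := h
    refine ⟨ε / 2, by positivity, fun ζ hζ => h ?_ ?_⟩
    · rw [mem_sphere.1 hζ]; linarith
    · rintro rfl; simp at hζ; linarith
  have hcpt : IsCompact (sphere ζ₀ s) := isCompact_sphere _ _
  have hsphΩ : sphere ζ₀ s ⊆ {ζ | G ζ = 0}ᶜ := hcirc
  have hlower : ∀ H : ℂ → ℂ, Continuous H → (∀ ζ ∈ sphere ζ₀ s, H ζ ≠ 0) →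
      ∃ ε > 0, ∀ ζ ∈ sphere ζ₀ s, ε ≤ ‖H ζ‖ := by
    intro H hH hne
    obtain ⟨y, hy, hmin⟩ := hcpt.exists_isMinOn (NormedSpace.sphere_nonempty.2 hs.le)
      hH.norm.continuousOn
    exact ⟨_, norm_pos_iff.2 (hne y hy), fun ζ hζ => hmin hζ⟩
  obtain ⟨ε, hε, hεG⟩ := hlower G hG.continuous hcirc
  obtain ⟨c₁, hc₁, hcG⟩ := hlower (fun ζ => G ζ - 1) (hG.continuous.sub continuous_const)
    fun ζ _ => sub_ne_zero.2 (hG1 ζ)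
  obtain ⟨M₁, hM₁⟩ := hcpt.exists_bound_of_continuousOn hG.continuous.continuousOn
  have hsubR : closedBall ζ₀ s ⊆ ball 0 (‖ζ₀‖ + s + 1) := fun ζ hζ => by
    rw [mem_closedBall, dist_eq_norm] at hζ
    rw [mem_ball_zero_iff]
    have := norm_sub_norm_le ζ ζ₀
    linarith
  have hRpos : 0 < ‖ζ₀‖ + s + 1 := by positivity
  have hunc := hun _ (isCompact_closedBall ζ₀ s)
  -- the image of the disc covers a large disc about the origin
  have hcover : ∀ᶠ n in atTop, ball (0 : ℂ) (ε * W n / 64) ⊆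
      (fun ζ => f (p n ζ)) '' closedBall ζ₀ s := by
    filter_upwards [hpW _ hRpos, hplarge _ hRpos,
      Metric.tendstoUniformlyOn_iff.1 hunc (ε / 2) (by positivity),
      Metric.tendstoUniformlyOn_iff.1 hunc (ε / 128) (by positivity)] with n h1 h2 h3 h4
    have hWn := hW0 n
    have hfp : ∀ ζ ∈ closedBall ζ₀ s, ‖f (p n ζ)‖ = ‖q (p n ζ)‖ * ‖p n ζ‖ := by
      intro ζ hζ
      rw [← norm_mul, div_mul_cancel₀ _ (h2 ζ (hsubR hζ)).2]
    have hcen : ‖f (p n ζ₀)‖ ≤ ε * W n / 64 := by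
      have hmem : ζ₀ ∈ closedBall ζ₀ s := mem_closedBall_self hs.le
      have h5 := h4 ζ₀ hmem
      rw [hζ₀, dist_eq_norm, zero_sub, norm_neg] at h5
      have h6 := (h1 ζ₀ (hsubR hmem)).2
      rw [hfp ζ₀ hmem]
      calc ‖q (p n ζ₀)‖ * ‖p n ζ₀‖ ≤ ε / 128 * (2 * W n) := by gcongr
        _ = _ := by ring
    have hbdry : ∀ ζ ∈ sphere ζ₀ s, ε * W n / 4 ≤ ‖f (p n ζ)‖ := by
      intro ζ hζ
      have hmem := sphere_subset_closedBall hζ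
      have h5 := h3 ζ hmem
      rw [dist_eq_norm] at h5
      have h6 := norm_sub_norm_le (G ζ) (q (p n ζ))
      have h7 := hεG ζ hζ
      have h8 : ε / 2 ≤ ‖q (p n ζ)‖ := by linarith
      have h9 := (h1 ζ (hsubR hmem)).1
      rw [hfp ζ hmem]
      calc ε * W n / 4 = ε / 2 * (W n / 2) := by ring
        _ ≤ _ := by gcongr
    have hεW : 0 < ε * W n := by positivity
    have hfpd : Differentiable ℂ fun ζ => f (p n ζ) := hfd.comp (hpd n)
    have hdiff : ∀ ζ ∈ sphere ζ₀ s, ε * W n / 8 ≤ ‖f (p n ζ) - f (p n ζ₀)‖ := by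
      intro ζ hζ
      have h5 := hbdry ζ hζ
      have h6 := norm_sub_norm_le (f (p n ζ)) (f (p n ζ₀))
      linarith
    have himg := hfpd.diffContOnCl.ball_subset_image_closedBall hs hdiff (by
      intro hcon
      simp only [not_not] at hcon
      have h5 := eq_const_of_eventually_eq hfpd hcon
      obtain ⟨ζ, hζ⟩ := NormedSpace.sphere_nonempty (x := ζ₀).2 hs.le
      have h6 := hdiff ζ hζ
      rw [congrFun h5 ζ, sub_self, norm_zero] at h6
      linarith)
    -- The image contains the disc of radius εW/16 about f(p n ζ₀), whose modulus is at most εW/64.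
    refine Subset.trans (ball_subset_ball' ?_) himg
    rw [dist_eq_norm, zero_sub, norm_neg]
    linarith
  have hψe : ∀ {P : ℕ → Prop}, (∀ᶠ n in atTop, P n) → ∀ᶠ n in atTop, P (ψ n) :=
    fun h => hψ.tendsto_atTop.eventually h
  have hq1 : ∀ᶠ n in atTop, ∀ ζ ∈ sphere ζ₀ s,
      ‖q (p n ζ) - 1‖ ≤ M₁ + 2 ∧ c₁ / 2 ≤ ‖q (p n ζ) - 1‖ := by
    filter_upwards [Metric.tendstoUniformlyOn_iff.1 hunc 1 one_pos,
      Metric.tendstoUniformlyOn_iff.1 hunc (c₁ / 2) (by positivity)] with n h1 h2 ζ hζ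
    have h3 := h1 ζ (sphere_subset_closedBall hζ)
    have h4 := h2 ζ (sphere_subset_closedBall hζ)
    rw [dist_comm, dist_eq_norm] at h3
    rw [dist_eq_norm] at h4
    have h5 := hM₁ ζ hζ
    have h6 := hcG ζ hζ
    constructor
    · calc ‖q (p n ζ) - 1‖ = ‖(q (p n ζ) - G ζ) + G ζ - 1‖ := by ring_nf
        _ ≤ ‖(q (p n ζ) - G ζ) + G ζ‖ + ‖(1 : ℂ)‖ := norm_sub_le _ _
        _ ≤ ‖q (p n ζ) - G ζ‖ + ‖G ζ‖ + ‖(1 : ℂ)‖ := by gcongr; exact norm_add_le _ _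
        _ ≤ M₁ + 2 := by rw [norm_one]; linarith
    · have h7 := norm_sub_norm_le (G ζ - 1) (q (p n ζ) - 1)
      rw [sub_sub_sub_cancel_right] at h7
      linarith
  have hffp : ∀ᶠ n in atTop, ∀ ζ ∈ sphere ζ₀ s,
      ‖f (f (p n ζ)) - p n ζ‖ = ‖p n ζ‖ * (‖k n ζ‖ * ‖q (p n ζ) - 1‖) := by
    filter_upwards [hplarge _ hRpos, hq1] with n h1 h2 ζ hζ
    have h3 := (h1 ζ (hsubR (sphere_subset_closedBall hζ))).2
    have h4 : q (p n ζ) - 1 ≠ 0 := by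
      rw [← norm_pos_iff]; have := (h2 ζ hζ).2; linarith
    rw [← norm_mul, ← norm_mul, div_mul_cancel₀ _ h4]
    congr 1
    field_simp
  have hfr : frontier (ball ζ₀ s) = sphere ζ₀ s := frontier_ball _ hs.ne'
  have hcl : closure (ball ζ₀ s) = closedBall ζ₀ s := closure_ball _ hs.ne'
  rcases hdich with ⟨K, hK⟩ | hinf
  · have hunK : TendstoUniformlyOn (fun n => k (ψ n)) K atTop (sphere ζ₀ s) :=
      (tendstoLocallyUniformlyOn_iff_tendstoUniformlyOn_of_compact hcpt).1 (hK.mono hsphΩ)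
    have hkcont : ∀ᶠ n in atTop, ContinuousOn (k n) (sphere ζ₀ s) := by
      filter_upwards [hplarge _ hRpos, hq1] with n h1 h2
      intro ζ hζ
      have h3 := (h1 ζ (hsubR (sphere_subset_closedBall hζ))).2
      have h4 : q (p n ζ) - 1 ≠ 0 := by
        rw [← norm_pos_iff]; have := (h2 ζ hζ).2; linarith
      have hffp : ContinuousAt (fun ζ => f (f (p n ζ))) ζ :=
        (hfd.comp (hfd.comp (hpd n))).continuous.continuousAt
      have hpc : ContinuousAt (p n) ζ := (hpd n).continuous.continuousAt
      have hqp : ContinuousAt (fun ζ => q (p n ζ)) ζ :=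
        ((hqd _ h3).comp ζ (hpd n ζ)).continuousAt
      exact (((hffp.div₀ hpc h3).sub continuousAt_const).div₀
        (hqp.sub continuousAt_const) h4).continuousWithinAt
    obtain ⟨M₂, hM₂⟩ := hcpt.exists_bound_of_continuousOn
      (hunK.continuousOn (hψe hkcont).frequently)
    set M₃ := 2 * ((M₂ + 1) * (M₁ + 2)) + 2 with hM₃
    -- A finite limit of k makes f ∘ f ∘ p of size O(W) on the circle, hence inside. Since f ∘ p
    -- covers a disc of radius comparable to W, f itself grows at most linearly.
    have hbound : ∀ᶠ n in atTop, ∀ y ∈ ball (0 : ℂ) (ε * W (ψ n) / 64), ‖f y‖ ≤ M₃ * W (ψ n) := by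
      filter_upwards [hψe hcover, hψe hq1, hψe hffp, hψe (hpW _ hRpos),
        Metric.tendstoUniformlyOn_iff.1 hunK 1 one_pos] with n h1 h2 h3 h4 h5 y hy
      obtain ⟨ζ, hζ, rfl⟩ := h1 hy
      refine Complex.norm_le_of_forall_mem_frontier_norm_le (f := fun ζ => f (f (p (ψ n) ζ)))
        (isBounded_ball (x := ζ₀) (r := s)) (hfd.comp (hfd.comp (hpd _))).diffContOnCl ?_
        (by rwa [hcl])
      intro ξ hξ
      rw [hfr] at hξ
      have h6 := (h4 ξ (hsubR (sphere_subset_closedBall hξ))).2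
      have h7 := (h2 ξ hξ).1
      have h8 := h5 ξ hξ
      rw [dist_comm, dist_eq_norm] at h8
      have h9 := norm_sub_norm_le (k (ψ n) ξ) (K ξ)
      have h10 := hM₂ ξ hξ
      have h11 : ‖k (ψ n) ξ‖ ≤ M₂ + 1 := by linarith
      have h12 : 0 ≤ M₂ + 1 := (norm_nonneg _).trans h11
      have hWn := hW0 (ψ n)
      calc ‖f (f (p (ψ n) ξ))‖ = ‖(f (f (p (ψ n) ξ)) - p (ψ n) ξ) + p (ψ n) ξ‖ := by
            rw [sub_add_cancel]
        _ ≤ ‖f (f (p (ψ n) ξ)) - p (ψ n) ξ‖ + ‖p (ψ n) ξ‖ := norm_add_le _ _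
        _ ≤ 2 * W (ψ n) * ((M₂ + 1) * (M₁ + 2)) + 2 * W (ψ n) := by
            rw [h3 ξ hξ]; gcongr
        _ = M₃ * W (ψ n) := by rw [hM₃]; ring
    have htop : Tendsto (fun n => ε * W (ψ n) / 128) atTop atTop :=
      ((hWtop.comp hψ.tendsto_atTop).const_mul_atTop hε).atTop_div_const (by norm_num)
    obtain ⟨P, hP⟩ := exists_polynomial_of_frequently_norm_le hfd (C := 128 * M₃ / ε) (n := 1) (by
      refine htop.frequently (Eventually.frequently ?_)
      filter_upwards [hbound] with n hn y hy
      have hWn := hW0 (ψ n)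
      have hεW : 0 < ε * W (ψ n) := by positivity
      refine (hn y (by
        rw [mem_ball_zero_iff, mem_sphere_zero_iff_norm.1 hy]; linarith)).trans (le_of_eq ?_)
      field_simp)
    exact hf.2 P hP
  -- On the circle ‖k‖ > 16/c₁, ‖q - 1‖ ≥ c₁/2 and ‖p‖ ≥ W/2 give ‖e‖ ≥ 4W. The zero-free e keeps
  -- this bound inside, but where f ∘ p = 0 it is at most ‖f 0‖ + 2W < 3W.
  · obtain ⟨n, h1, h2, h3, h4, h5, h6, h7⟩ := ((hψe hcover).and ((hψe hq1).and ((hψe hffp).and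
      ((hψe (hpW _ hRpos)).and ((hψe (hplarge _ hRpos)).and
      ((hinf _ hsphΩ hcpt (16 / c₁)).and
      ((hWtop.comp hψ.tendsto_atTop).eventually_gt_atTop ‖f 0‖))))))).exists
    have hWn := hW0 (ψ n)
    set e : ℂ → ℂ := fun ζ => f (f (p (ψ n) ζ)) - p (ψ n) ζ with he
    have hed : Differentiable ℂ e := (hfd.comp (hfd.comp (hpd _))).sub (hpd _)
    have hene : ∀ ζ ∈ closedBall ζ₀ s, e ζ ≠ 0 := fun ζ hζ h =>
      hfix _ (h5 ζ (hsubR hζ)).1 (sub_eq_zero.1 h)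
    obtain ⟨ζ, hζ, hζ0⟩ := h1 (mem_ball_self (by positivity))
    simp only at hζ0
    have hmin : ‖(e ζ)⁻¹‖ ≤ (4 * W (ψ n))⁻¹ := by
      refine Complex.norm_le_of_forall_mem_frontier_norm_le (f := fun ζ => (e ζ)⁻¹)
        (isBounded_ball (x := ζ₀) (r := s)) ?_ ?_ (by rwa [hcl])
      · refine DifferentiableOn.diffContOnCl ?_
        rw [hcl]
        exact hed.differentiableOn.fun_inv hene
      · intro ξ hξ
        rw [hfr] at hξ
        rw [norm_inv]
        refine inv_anti₀ (by positivity) ?_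
        have h8 := (h4 ξ (hsubR (sphere_subset_closedBall hξ))).1
        have h9 := (h2 ξ hξ).2
        have h10 := (h6 ξ hξ).le
        simp only [he]
        rw [h3 ξ hξ]
        calc 4 * W (ψ n) = W (ψ n) / 2 * (16 / c₁ * (c₁ / 2)) := by field_simp; norm_num
          _ ≤ _ := by gcongr
    rw [norm_inv] at hmin
    have h8 := (inv_le_inv₀ (norm_pos_iff.2 (hene ζ hζ)) (by positivity)).1 hmin
    have h9 : ‖e ζ‖ ≤ ‖f 0‖ + 2 * W (ψ n) := by
      simp only [he]
      rw [hζ0]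
      refine (norm_sub_le _ _).trans ?_
      gcongr
      exact (h4 ζ (hsubR hζ)).2
    simp only [Function.comp] at h7
    linarith

/-! ### Generated semigroups and infinitude of the Julia set -/

theorem generated_subset {A : Set (ℂ → ℂ)} {h : ℂ → ℂ} (hh : h ∈ generated A) :
    generated {h} ⊆ generated A := by
  intro k hk
  induction hk with
  | of ha => rw [mem_singleton_iff.1 ha]; exact hh
  | comp _ _ ih₁ ih₂ => exact IsComposition.comp ih₁ ih₂

theorem differentiable_of_mem_generated {A : Set (ℂ → ℂ)} (hA : ∀ a ∈ A, Differentiable ℂ a)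
    {h : ℂ → ℂ} (hh : h ∈ generated A) : Differentiable ℂ h := by
  induction hh with
  | of ha => exact hA _ ha
  | comp _ _ ih₁ ih₂ => exact ih₁.comp ih₂

theorem isOpenMap_of_mem_generated {A : Set (ℂ → ℂ)} (hA : ∀ a ∈ A, IsOpenMap a)
    {h : ℂ → ℂ} (hh : h ∈ generated A) : IsOpenMap h := by
  induction hh with
  | of ha => exact hA _ ha
  | comp _ _ ih₁ ih₂ => exact ih₁.comp ih₂

theorem iterate_succ_mem_generated {A : Set (ℂ → ℂ)} {h : ℂ → ℂ} (hh : h ∈ generated A) (n : ℕ) :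
    h^[n + 1] ∈ generated A := by
  induction n with
  | zero => simpa using hh
  | succ n ih => exact IsComposition.comp ih hh

theorem IsTranscendentalEntire.isOpenMap {f : ℂ → ℂ} (hf : IsTranscendentalEntire f) :
    IsOpenMap f := by
  rcases (hf.1.differentiableOn.analyticOnNhd isOpen_univ).is_constant_or_isOpenMap with
    ⟨c, h⟩ | h
  · exact absurd (funext fun z => by simpa using h z) (hf.2 (Polynomial.C c))
  · exact h

/-- The image of a small disc about a ∈ D is open, and injectivity keeps far-away points from taking
values in it. So f stays away from f a near ∞ and is a polynomial. -/
theorem IsTranscendentalEntire.not_injOn {f : ℂ → ℂ} (hf : IsTranscendentalEntire f) {D : Set ℂ}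
    (hD : IsOpen D) (hbdd : Bornology.IsBounded Dᶜ) : ¬ InjOn f D := by
  intro hinj
  obtain ⟨R, hR⟩ := isBounded_iff_forall_norm_le.1 hbdd
  have hmem : ∀ z, R < ‖z‖ → z ∈ D := fun z hz => by
    by_contra h
    exact absurd (hR z h) (not_le.2 hz)
  set a : ℂ := ((|R| + 1 : ℝ) : ℂ)
  have han : ‖a‖ = |R| + 1 := by
    simp only [a]; rw [Complex.norm_real, Real.norm_of_nonneg (by positivity)]
  have ha : a ∈ D := hmem a (by rw [han]; linarith [le_abs_self R])
  obtain ⟨δ, hδ, hball⟩ := Metric.isOpen_iff.1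
    (hf.isOpenMap (ball a 1 ∩ D) (isOpen_ball.inter hD)) (f a)
    (mem_image_of_mem f ⟨mem_ball_self one_pos, ha⟩)
  obtain ⟨p, hp⟩ := exists_polynomial_of_le_norm_sub hf.1 (c := f a) (R := |R| + 3 + ‖a‖) hδ
    (fun z hz => by
      by_contra! hlt
      have hzD : z ∈ D := hmem z (by linarith [le_abs_self R, norm_nonneg a])
      obtain ⟨y, ⟨hy, hyD⟩, hyz⟩ := hball (mem_ball_iff_norm.2 hlt)
      rw [hinj hyD hzD hyz, mem_ball_iff_norm] at hy
      have := norm_sub_norm_le z a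
      linarith [abs_nonneg R])
  exact hf.2 p hp

/-- The converse half of Marty's theorem; it lets normality on small discs be glued over a connected
domain. -/
theorem IsNormalOn.exists_sph_bound {S : Set (ℂ → ℂ)} (hS : ∀ h ∈ S, Differentiable ℂ h) {z : ℂ}
    {r : ℝ} (hr : 0 < r) (hn : IsNormalOn S (ball z r)) :
    ∃ s > 0, ∃ C, ∀ h ∈ S, ∀ w ∈ ball z s, sph h w ≤ C := by
  refine ⟨r / 4, by positivity, ?_⟩
  by_contra! hcon
  choose s hs w hw hsw using fun n : ℕ => hcon n
  obtain ⟨φ, hφ, h⟩ := hn s hs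
  have hsub : closedBall z (r / 2) ⊆ ball z r := closedBall_subset_ball (by linarith)
  have hcpt : IsCompact (closedBall z (r / 2)) := isCompact_closedBall _ _
  have hwsub : ∀ n, ball (w n) (r / 4) ⊆ closedBall z (r / 2) := fun n =>
    (ball_subset_ball' (by have := mem_ball.1 (hw n); linarith)).trans ball_subset_closedBall
  have hcontra : ∀ C : ℝ, ¬ ∀ᶠ n in atTop, sph (s (φ n)) (w (φ n)) ≤ C := by
    intro C hC
    obtain ⟨n, h1, h2⟩ := (hC.and
      ((tendsto_natCast_atTop_atTop.comp hφ.tendsto_atTop).eventually_gt_atTop C)).exists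
    have := hsw (φ n)
    simp only [Function.comp] at h2
    linarith
  rcases h with ⟨G, hG⟩ | h
  · have hun : TendstoUniformlyOn (fun n => s (φ n)) G atTop (closedBall z (r / 2)) :=
      (tendstoLocallyUniformlyOn_iff_tendstoUniformlyOn_of_compact hcpt).1 (hG.mono hsub)
    obtain ⟨M, hM⟩ := hcpt.exists_bound_of_continuousOn (hun.continuousOn
      (Frequently.of_forall fun n => (hS _ (hs (φ n))).continuous.continuousOn))
    refine hcontra (2 * (M + 1) / (r / 4)) ?_
    filter_upwards [Metric.tendstoUniformlyOn_iff.1 hun 1 one_pos] with n hn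
    refine sph_le_of_norm_le (by positivity) (hS _ (hs _)).differentiableOn fun y hy => ?_
    have h1 := hn y (hwsub _ hy)
    have h2 := hM y (hwsub _ hy)
    rw [dist_comm, dist_eq_norm] at h1
    have := norm_sub_norm_le (s (φ n) y) (G y)
    linarith
  · refine hcontra (2 * (1 : ℝ)⁻¹ / (r / 4)) ?_
    filter_upwards [h _ hsub hcpt 1] with n hn
    exact sph_le_of_le_norm (by positivity) one_pos (hS _ (hs _)).differentiableOn
      fun y hy => (hn y (hwsub _ hy)).le

/-- The Julia set of a transcendental entire function is infinite. -/
theorem IsTranscendentalEntire.infinite_juliaSet {f : ℂ → ℂ} (hf : IsTranscendentalEntire f) :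
    (juliaSet f).Infinite := by
  intro hfin
  set D := (juliaSet f)ᶜ with hDdef
  have hDo : IsOpen D := hfin.isClosed.isOpen_compl
  have hDc : IsPreconnected D :=
    (hfin.countable.isConnected_compl_of_one_lt_rank (by simp)).isPreconnected
  have hDb : Bornology.IsBounded Dᶜ := by rw [hDdef, compl_compl]; exact hfin.isBounded
  have hgen : ∀ h ∈ generated {f}, Differentiable ℂ h := fun h hh =>
    differentiable_of_mem_generated (fun a ha => by rw [mem_singleton_iff.1 ha]; exact hf.1) hh
  have hsub : ∀ s : ℕ → ℂ → ℂ, (∀ n, s n ∈ generated {f}) → ∃ φ : ℕ → ℕ, StrictMono φ ∧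
      ((∃ G : ℂ → ℂ, TendstoLocallyUniformlyOn (fun n => s (φ n)) G atTop D) ∨
        TendstoInftyLocallyUniformlyOn (fun n => s (φ n)) D) := by
    intro s hs
    refine exists_subseq_of_sph_bounded hDc fun x hx => ?_
    rw [hDdef, juliaSet, compl_compl] at hx
    obtain ⟨r, hr, hn⟩ := hx
    obtain ⟨t, ht, C, hC⟩ := hn.exists_sph_bound hgen hr
    exact ⟨t, ht, C, Eventually.of_forall fun n => ⟨(hgen _ (hs n)).differentiableOn, hC _ (hs n)⟩⟩
  obtain ⟨R, hR⟩ := isBounded_iff_forall_norm_le.1 hDb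
  have hmem : ∀ z, R < ‖z‖ → z ∈ D := fun z hz => by
    by_contra h
    exact absurd (hR z h) (not_le.2 hz)
  obtain ⟨p₁, hp₁R, hp₁⟩ := exists_large_fixed_point hf R
  obtain ⟨p₂, hp₂R, hp₂⟩ := exists_large_fixed_point hf ‖p₁‖
  have hp₁D := hmem p₁ hp₁R
  have hp₂D := hmem p₂ (hp₁R.trans hp₂R)
  have hpne : p₁ ≠ p₂ := by rintro rfl; exact lt_irrefl _ hp₂R
  set F := f ∘ f with hF
  have hFgen : F ∈ generated {f} :=
    IsComposition.comp (IsComposition.of rfl) (IsComposition.of rfl)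
  have hfix : ∀ {p}, f (f p) = p → ∀ n, F^[n] p = p := fun h n =>
    Function.iterate_fixed (show F _ = _ from h) n
  -- sequences of iterates of `F` have finite limits, since `p₁` is fixed
  have hfinite : ∀ e : ℕ → ℕ, ∃ φ : ℕ → ℕ, StrictMono φ ∧
      ∃ G : ℂ → ℂ, TendstoLocallyUniformlyOn (fun n => F^[e (φ n) + 1]) G atTop D := by
    intro e
    obtain ⟨φ, hφ, h | h⟩ := hsub (fun n => F^[e n + 1])
      fun n => iterate_succ_mem_generated hFgen _
    · exact ⟨φ, hφ, h⟩
    · obtain ⟨n, hn⟩ := (h {p₁} (by simpa using hp₁D) isCompact_singleton ‖p₁‖).exists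
      have := hn p₁ rfl
      simp only at this
      rw [hfix hp₁] at this
      exact absurd this (lt_irrefl _)
  have hitd : ∀ n, DifferentiableOn ℂ (F^[n + 1]) D := fun n =>
    (hgen _ (iterate_succ_mem_generated hFgen n)).differentiableOn
  obtain ⟨φ, hφ, G, hG⟩ := hfinite id
  -- With the extra 1 in `hfinite` the exponent is the gap φ(n+1) - φ(n), so composing with F^[φ n +
  -- 1] yields F^[φ (n+1) + 1], and H ∘ G = G in the limit.
  obtain ⟨ψ, hψ, H, hH⟩ := hfinite fun n => φ (n + 1) - φ n - 1
  have hGd : DifferentiableOn ℂ G D :=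
    hG.differentiableOn (Eventually.of_forall fun n => hitd _) hDo
  have hHd : DifferentiableOn ℂ H D :=
    hH.differentiableOn (Eventually.of_forall fun n => hitd _) hDo
  have hGp : ∀ {p}, f (f p) = p → p ∈ D → G p = p := by
    intro p hp hpD
    refine tendsto_nhds_unique (hG.tendsto_at hpD) ?_
    simp only [hfix hp]
    exact tendsto_const_nhds
  have hGc : ContinuousAt G p₁ := hGd.continuousOn.continuousAt (hDo.mem_nhds hp₁D)
  have hHG : ∀ᶠ z in 𝓝 p₁, H (G z) = G z := by
    have h1 : ∀ᶠ z in 𝓝 p₁, G z ∈ D :=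
      hGc.eventually_mem (by rw [hGp hp₁ hp₁D]; exact hDo.mem_nhds hp₁D)
    filter_upwards [h1, hDo.mem_nhds hp₁D] with z hz hzD
    have h2 : Tendsto (fun n => F^[φ (ψ n) + 1] z) atTop (𝓝 (G z)) :=
      (hG.tendsto_at hzD).comp hψ.tendsto_atTop
    have h3 : Tendsto (fun n => F^[φ (ψ n + 1) - φ (ψ n) - 1 + 1] (F^[φ (ψ n) + 1] z)) atTop
        (𝓝 (H (G z))) :=
      hH.tendsto_comp (hHd.continuousOn _ hz) hz (by
        rw [hDo.nhdsWithin_eq hz]; exact h2)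
    have h4 : Tendsto (fun n => F^[φ (ψ n + 1) + 1] z) atTop (𝓝 (G z)) :=
      (hG.tendsto_at hzD).comp ((tendsto_add_atTop_nat 1).comp hψ.tendsto_atTop)
    refine tendsto_nhds_unique h3 (h4.congr fun n => ?_)
    have h5 : φ (ψ n) < φ (ψ n + 1) := hφ (Nat.lt_succ_self _)
    have h6 : φ (ψ n + 1) - φ (ψ n) - 1 + 1 + (φ (ψ n) + 1) = φ (ψ n + 1) + 1 := by omega
    rw [← Function.iterate_add_apply, h6]
  have hGan : AnalyticOnNhd ℂ G D := hGd.analyticOnNhd hDo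
  have hHid : EqOn H id D := by
    refine (hHd.analyticOnNhd hDo).eqOn_of_preconnected_of_eventuallyEq analyticOnNhd_id hDc
      hp₁D ?_
    -- G fixes two distinct points, so it is not constant. It is therefore open at p₁, and H is the
    -- identity on a neighbourhood of p₁.
    rcases (hGan p₁ hp₁D).eventually_constant_or_nhds_le_map_nhds with h | h
    · have := hGan.eqOn_of_preconnected_of_eventuallyEq (analyticOnNhd_const (v := G p₁)) hDc
        hp₁D h hp₂D
      rw [hGp hp₁ hp₁D, hGp hp₂ hp₂D] at this
      exact absurd this.symm hpne
    · rw [hGp hp₁ hp₁D] at h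
      exact h hHG
  -- Positive iterates of F factor through f, so f a = f b gives equal sequences, with limits a and
  -- b.
  refine hf.not_injOn hDo hDb fun a ha b hb hab => ?_
  have hla := hH.tendsto_at ha
  have hlb := hH.tendsto_at hb
  rw [hHid ha] at hla
  rw [hHid hb] at hlb
  refine tendsto_nhds_unique hla (hlb.congr fun n => ?_)
  simp only [Function.iterate_succ_apply]
  simp only [hF, Function.comp_apply, hab]

/-! ### Minimality and invariance of the closure -/

/-- Off E every iterate omits the points a, b of E. An affine change moves them to 0 and 1, where
Montel's bound gives normality. -/
theorem juliaSet_subset_of_completelyInvariant {h : ℂ → ℂ} (hh : Differentiable ℂ h) {E : Set ℂ}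
    (hE : IsClosed E) (hinv : ∀ k ∈ generated {h}, k ⁻¹' E ⊆ E) (hcard : 1 < E.encard) :
    juliaSet h ⊆ E := by
  obtain ⟨a, b, ha, hb, hab⟩ := one_lt_encard_iff.1 hcard
  rw [juliaSet, compl_subset_comm]
  intro z hz
  obtain ⟨r, hr, hball⟩ := Metric.isOpen_iff.1 hE.isOpen_compl z hz
  refine ⟨r, hr, fun s hs => ?_⟩
  have hd : ∀ n, Differentiable ℂ (s n) := fun n => differentiable_of_mem_generated
    (fun a ha => by rw [mem_singleton_iff.1 ha]; exact hh) (hs n)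
  have hom : ∀ n, ∀ w ∈ ball z r, s n w ∉ E := fun n w hw hmem =>
    hball hw (hinv _ (hs n) hmem)
  have hba : b - a ≠ 0 := sub_ne_zero.2 hab.symm
  obtain ⟨C, hC⟩ := exists_sph_bound
  obtain ⟨φ, hφ, hlim⟩ := exists_subseq_of_sph_bounded (convex_ball z r).isPreconnected
    (F := fun n w => (s n w - a) / (b - a)) (by
    intro x hx
    have hpos : 0 < r - dist x z := sub_pos.2 (mem_ball.1 hx)
    have hsub : ball x (r - dist x z) ⊆ ball z r := ball_subset_ball' (by linarith)
    refine ⟨(r - dist x z) / 2, by positivity, C / (r - dist x z), Eventually.of_forall fun n => ?_⟩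
    have hdn : Differentiable ℂ fun w => (s n w - a) / (b - a) := ((hd n).sub_const a).div_const _
    refine ⟨hdn.differentiableOn, hC _ x _ hpos hdn.differentiableOn fun w hw => ⟨?_, ?_⟩⟩
    · refine div_ne_zero (sub_ne_zero.2 fun h => hom n w (hsub hw) (h ▸ ha)) hba
    · intro h
      rw [div_eq_one_iff_eq hba] at h
      exact hom n w (hsub hw) (sub_left_injective h ▸ hb))
  have hback : ∀ n w, s n w = (b - a) * ((s n w - a) / (b - a)) + a := fun n w => by
    rw [mul_div_cancel₀ _ hba, sub_add_cancel]
  refine ⟨φ, hφ, ?_⟩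
  rcases hlim with ⟨G, hG⟩ | h
  · left
    refine ⟨fun w => (b - a) * G w + a, Metric.tendstoLocallyUniformlyOn_iff.2 fun ε hε x hx => ?_⟩
    have hba' : 0 < ‖b - a‖ := norm_pos_iff.2 hba
    obtain ⟨t, ht, h⟩ := Metric.tendstoLocallyUniformlyOn_iff.1 hG (ε / ‖b - a‖) (by positivity) x hx
    refine ⟨t, ht, h.mono fun n hn y hy => ?_⟩
    have := hn y hy
    rw [hback (φ n) y, dist_add_right, dist_eq_norm, ← mul_sub, norm_mul]
    rw [dist_eq_norm, lt_div_iff₀ hba'] at this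
    linarith
  · right
    intro K hK hKc M
    have hba' : 0 < ‖b - a‖ := norm_pos_iff.2 hba
    filter_upwards [h K hK hKc ((M + ‖a‖) / ‖b - a‖)] with n hn w hw
    have h1 := hn w hw
    rw [norm_div, div_lt_div_iff_of_pos_right hba'] at h1
    have := norm_sub_le (s (φ n) w) a
    linarith

theorem subset_of_mem_level {S : Set (ℂ → ℂ)} {E : Set ℂ} (hJ : ∀ h ∈ S, juliaSet h ⊆ E)
    (hinv : ∀ h ∈ S, CompletelyInvariant h E) (n : ℕ) : ∀ A ∈ level S n, A ⊆ E := by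
  induction n with
  | zero =>
    rintro A ⟨h, hh, rfl⟩
    exact hJ h hh
  | succ n ih =>
    rintro A (⟨h, hh, B, hB, rfl⟩ | ⟨h, hh, B, hB, rfl⟩)
    · exact (preimage_mono (ih B hB)).trans (hinv h hh).2
    · exact (image_mono (ih B hB)).trans (hinv h hh).1

/-- Images and preimages of a member of one level lie in the next. Continuity passes forward
invariance to the closure, and openness passes backward invariance. -/
theorem completelyInvariant_closure_orbitCollection {S : Set (ℂ → ℂ)} {h : ℂ → ℂ} (hh : h ∈ S)
    (hc : Continuous h) (ho : IsOpenMap h) :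
    CompletelyInvariant h (closure (⋃ A ∈ orbitCollection S, A)) := by
  constructor
  · refine (image_closure_subset_closure_image hc).trans (closure_mono ?_)
    rintro _ ⟨z, hz, rfl⟩
    obtain ⟨A, hA, hzA⟩ := mem_iUnion₂.1 hz
    obtain ⟨n, hn⟩ := mem_iUnion.1 hA
    exact mem_iUnion₂.2 ⟨h '' A, mem_iUnion.2 ⟨n + 1, Or.inr ⟨h, hh, A, hn, rfl⟩⟩,
      mem_image_of_mem h hzA⟩
  · refine (ho.preimage_closure_subset_closure_preimage).trans (closure_mono ?_)
    intro z hz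
    obtain ⟨A, hA, hzA⟩ := mem_iUnion₂.1 hz
    obtain ⟨n, hn⟩ := mem_iUnion.1 hA
    exact mem_iUnion₂.2 ⟨h ⁻¹' A, mem_iUnion.2 ⟨n + 1, Or.inl ⟨h, hh, A, hn, rfl⟩⟩, hzA⟩

end TransSemigroup

theorem theorem3p1 (f g : ℂ → ℂ)
    (hf : TransSemigroup.IsTranscendentalEntire f)
    (hg : TransSemigroup.IsTranscendentalEntire g) :
    TransSemigroup.completelyInvariantJulia (TransSemigroup.generated {f, g}) =
      closure (⋃ A ∈ TransSemigroup.orbitCollection (TransSemigroup.generated {f, g}), A) := by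
  open TransSemigroup in
  have hd : ∀ h ∈ generated {f, g}, Differentiable ℂ h := fun h hh =>
    differentiable_of_mem_generated (by rintro a (rfl | rfl); exacts [hf.1, hg.1]) hh
  open TransSemigroup in
  have ho : ∀ h ∈ generated {f, g}, IsOpenMap h := fun h hh =>
    isOpenMap_of_mem_generated (by rintro a (rfl | rfl); exacts [hf.isOpenMap, hg.isOpenMap]) hh
  refine Set.Subset.antisymm (Set.sInter_subset_of_mem ⟨isClosed_closure, fun h hh => ?_, ?_⟩) ?_
  · exact TransSemigroup.completelyInvariant_closure_orbitCollection hh (hd h hh).continuous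
      (ho h hh)
  · have hmem : TransSemigroup.juliaSet f ∈
        TransSemigroup.orbitCollection (TransSemigroup.generated {f, g}) :=
      Set.mem_iUnion.2 ⟨0, f, TransSemigroup.IsComposition.of (Or.inl rfl), rfl⟩
    have hsub : TransSemigroup.juliaSet f ⊆
        closure (⋃ A ∈ TransSemigroup.orbitCollection (TransSemigroup.generated {f, g}), A) :=
      Set.Subset.trans (Set.subset_biUnion_of_mem (u := fun A => A) hmem) subset_closure
    rw [(hf.infinite_juliaSet.mono hsub).encard_eq]
    exact le_top
  · refine Set.subset_sInter ?_
    rintro E ⟨hE, hinv, hcard⟩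
    refine closure_minimal ?_ hE
    refine Set.iUnion₂_subset fun A hA => ?_
    obtain ⟨n, hn⟩ := Set.mem_iUnion.1 hA
    refine TransSemigroup.subset_of_mem_level (fun h hh => ?_) hinv n A hn
    exact TransSemigroup.juliaSet_subset_of_completelyInvariant (hd h hh) hE
      (fun k hk => (hinv k (TransSemigroup.generated_subset hh hk)).2)
      (lt_of_lt_of_le (by norm_num) hcard)
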